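/- \textbf{Definitions.} Graphs are finite, simple and undirected. A \emph{$3$-tree} is defined recursively: $K_4$ is a $3$-tree, and the graph obtained from a $3$-tree by adding a new vertex adjacent to exactly the three vertices of an existing $3$-clique is a $3$-tree. A \emph{plane $3$-tree} is a planar $3$-tree together with a fixed combinatorial embedding in the plane (a cyclic order of the edges around each vertex that satisfies Euler's formula) and a specified outerface. A \emph{drawing} of a graph maps its vertices to distinct points of the plane, and represents each edge by the closed straight line segment between its endpoints, such that no edge contains a vertex other than its own endpoints. A drawing is \emph{plane} if no two distinct edges intersect at a point other than a common endpoint. A \emph{plane drawing of a plane graph} is a plane drawing that moreover preserves the given embedding (the anticlockwise cyclic order of the edges around each vertex is the given one) and the specified outerface (the outerface is drawn as the unbounded face). A \emph{segment} in a drawing is a maximal set of edges whose union is a line segment. The \emph{slope} of an edge is the angle in $[0,\pi)$ swept anticlockwise from the $x$-axis to the line through the edge; the number of slopes of a drawing is the number of distinct slopes of its edges. \textbf{Theorem.} (a) Every $n$-vertex plane $3$-tree has a plane drawing with at most $2n-2$ segments, and thus with at most $2n-2$ slopes. (b) For every integer $n\geq 4$ there is an $n$-vertex plane $3$-tree such that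 every plane drawing of it has at least $2n-2$ slopes, and thus at least $2n-2$ segments. -/

import Mathlib

universe u

open scoped Topology

noncomputable section

/-! ## `k`-trees -/

/-- `k`-trees: `K_{k+1}` is a `k`-tree, and so is every graph obtained from a `k`-tree by adding
a new vertex `v` adjacent to exactly the vertices of an existing `k`-clique. -/
inductive IsKTree (k : ℕ) : ∀ {V : Type u}, SimpleGraph V → Prop
  | complete {V : Type u} (hcard : Nat.card V = k + 1) : IsKTree k (⊤ : SimpleGraph V)
  | extend {V : Type u} (G : SimpleGraph V) (v : V)
      (hclique : G.IsClique (G.neighborSet v)) (hdeg : (G.neighborSet v).ncard = k)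
      (hrest : IsKTree k (G.induce ({v}ᶜ : Set V))) : IsKTree k G

/-! ## Plane graphs: combinatorial embeddings with a specified outerface -/

/-- A rotation system: a cyclic order (to be read counterclockwise) of the edges around each
vertex, given as the permutation that sends a dart `d` to the next dart with the same tail. -/
structure RotationSystem {V : Type u} (G : SimpleGraph V) where
  rot : Equiv.Perm G.Dart
  fst_rot : ∀ d, (rot d).fst = d.fst
  sameCycle_rot : ∀ d d' : G.Dart, d.fst = d'.fst → rot.SameCycle d d'

namespace RotationSystem

variable {V : Type u} {G : SimpleGraph V} (R : RotationSystem G)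

/-- The successor of a dart `d = (v, w)` on the boundary walk of the face to the left of `d`:
the dart at `w` that comes next in clockwise order after `(w, v)`. -/
def faceNext : Equiv.Perm G.Dart :=
  (Function.Involutive.toPerm SimpleGraph.Dart.symm SimpleGraph.Dart.symm_involutive).trans R.rot.symm

/-- The faces of a rotation system are the orbits of `faceNext`. -/
def Face : Type u := Quotient (Equiv.Perm.SameCycle.setoid R.faceNext)

/-- The face to the left of a dart. -/
def leftFace (d : G.Dart) : R.Face := Quotient.mk (Equiv.Perm.SameCycle.setoid R.faceNext) d

end RotationSystem

/-- A (connected) plane graph: a combinatorial embedding in the plane, that is, a rotation system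
that satisfies Euler's formula, together with a specified outerface. -/
structure PlaneEmbedding {V : Type u} [Fintype V] (G : SimpleGraph V) extends
    RotationSystem G where
  connected : G.Connected
  euler : (Fintype.card V : ℤ) - Nat.card G.edgeSet + Nat.card toRotationSystem.Face = 2
  outerFace : toRotationSystem.Face

/-! ## Straight-line drawings, segments and slopes (the plane is `ℂ`) -/

/-- The closed line segment that represents an edge when vertices are placed by `p`. -/
def edgeSegment {V : Type u} (p : V → ℂ) : Sym2 V → Set ℂ :=
  Sym2.lift ⟨fun v w => segment ℝ (p v) (p w), fun _ _ => segment_symm ℝ _ _⟩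

/-- Distinct vertices are placed at distinct points, and every edge contains no vertices other
than its own endpoints. -/
structure IsDrawing {V : Type u} (G : SimpleGraph V) (p : V → ℂ) : Prop where
  injective : Function.Injective p
  mem_of_mem_edgeSegment : ∀ e ∈ G.edgeSet, ∀ v : V, p v ∈ edgeSegment p e → v ∈ e

/-- Two edges cross if they intersect at some point other than a common endpoint. -/
def Crosses {V : Type u} (p : V → ℂ) (e f : Sym2 V) : Prop :=
  ∃ x ∈ edgeSegment p e ∩ edgeSegment p f, ¬ ∃ v : V, v ∈ e ∧ v ∈ f ∧ x = p v

/-- The drawing is plane: no two distinct edges cross. -/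
structure IsPlaneDrawing {V : Type u} (G : SimpleGraph V) (p : V → ℂ) : Prop extends
    IsDrawing G p where
  not_crosses : ∀ e ∈ G.edgeSet, ∀ f ∈ G.edgeSet, e ≠ f → ¬ Crosses p e f

/-- The set of edges `S` forms a line segment. -/
def FormsSegment {V : Type u} (G : SimpleGraph V) (p : V → ℂ) (S : Set (Sym2 V)) : Prop :=
  S ⊆ G.edgeSet ∧ ∃ a b : ℂ, a ≠ b ∧ ⋃ e ∈ S, edgeSegment p e = segment ℝ a b

/-- The number of segments of a drawing: a segment is a maximal set of edges that form a line
segment. -/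
def numSegments {V : Type u} (G : SimpleGraph V) (p : V → ℂ) : ℕ :=
  {S : Set (Sym2 V) | Maximal (FormsSegment G p) S}.ncard

/-- The slope, in `[0, π)`, of the line through two distinct points: the angle swept from the
real axis anticlockwise to that line. -/
def slopeAngle (a b : ℂ) : ℝ := toIcoMod Real.pi_pos 0 (Complex.arg (b - a))

/-- The number of distinct slopes of the edges of a drawing. -/
def numSlopes {V : Type u} (G : SimpleGraph V) (p : V → ℂ) : ℕ :=
  (Set.range fun d : G.Dart => slopeAngle (p d.fst) (p d.snd)).ncard

/-! ## Drawings of plane graphs -/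

/-- The anticlockwise angle from `z` to `w`, in `(0, 2π]`. -/
def ccwAngle (z w : ℂ) : ℝ := toIocMod Real.two_pi_pos 0 (Complex.arg w - Complex.arg z)

/-- The points of the plane covered by the drawing. -/
def drawnSet {V : Type u} (G : SimpleGraph V) (p : V → ℂ) : Set ℂ :=
  Set.range p ∪ ⋃ e ∈ G.edgeSet, edgeSegment p e

/-- The unbounded region (component of the complement) of a drawing. -/
def unboundedRegion {V : Type u} (G : SimpleGraph V) (p : V → ℂ) : Set ℂ :=
  {x | x ∉ drawnSet G p ∧ ¬ Bornology.IsBounded (connectedComponentIn (drawnSet G p)ᶜ x)}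

/-- The unbounded region lies to the left of the directed edge `d`: it contains all points that
are close enough to the midpoint of `d` on the left normal there. -/
def UnboundedOnLeft {V : Type u} (G : SimpleGraph V) (p : V → ℂ) (d : G.Dart) : Prop :=
  ∀ᶠ t : ℝ in 𝓝[>] 0,
    (p d.fst + p d.snd) / 2 + t * (Complex.I * (p d.snd - p d.fst)) ∈ unboundedRegion G p

/-- A plane drawing of a plane graph: a plane straight-line drawing that preserves the embedding
(`rot d` is drawn as the next edge anticlockwise after `d` around the tail of `d`) and the
outerface (the directed edges of the outerface are those with the unbounded region on their
left). -/
structure PlaneEmbedding.IsPlaneDrawingOf {V : Type u} [Fintype V] {G : SimpleGraph V}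
    (P : PlaneEmbedding G) (p : V → ℂ) : Prop extends IsPlaneDrawing G p where
  rot_next : ∀ d d' : G.Dart, d'.fst = d.fst →
    ccwAngle (p d.snd - p d.fst) (p (P.rot d).snd - p d.fst) ≤
      ccwAngle (p d.snd - p d.fst) (p d'.snd - p d.fst)
  outer_iff : ∀ d : G.Dart,
    P.toRotationSystem.leftFace d = P.outerFace ↔ UnboundedOnLeft G p d

end

/-! Upper bound. A `3`-tree has `3n - 6` edges, so Euler's formula gives `2n - 4` faces for `6n -
12` darts; no face has fewer than three darts, hence all faces are triangles
(`PlaneEmbedding.faceNext_faceNext_faceNext`). A `3`-tree can be built up from any of its triangles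
(`IsKTree.builtFrom`), in particular from the outer triangle `ABC`. Deleting the last vertex `v`,
whose neighbours form a triangle `abc`, merges the three faces at `v` into the face `abc`
(`FaceSystem.remove`), so the plane graph arises by inserting vertices into inner faces.

Planarity survives wherever `v` is put inside its face (`PartialDrawing.insert_vertex`), so the
position is free to save segments. The invariant is `Extendable`: into every inner face some edge
can be prolonged beyond a corner of the face. With `v` on such a prolongation, one of its three
edges continues an old segment and only two can start new ones; the three faces created at `v` are
entered by prolonging the edges that end at `v`. The first inserted vertex yields `K_4` with at most
six segments, which gives `2n - 2` (`exists_drawing_insert`, `exists_drawing`). Segments are counted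
by a set of edges that meets each of them (`numSegments_le_card`), and
`PartialDrawing.isPlaneDrawingOf` recovers rotation and outerface from the face triangles.

Lower bound. In the nested triangles `0 1 k`, `2 ≤ k < n`, with outerface `0 1 (n-1)`, the embedding
forces all vertices `k` to one side of the line `01`. Measured from the direction of `01`, the
angles of the edges `0k` increase with `k` and those of the edges `1k` decrease, while the edge from
`n-2` to `n-1` has a direction strictly between the two families. Together with `01` this makes
`2(n-2) + 2 = 2n - 2` distinct slopes (`card_le_numSlopes_nested`).

In both parts one inequality between slopes and segments suffices, because all edges of a segment
have the same slope (`numSlopes_le_numSegments`). -/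

noncomputable section

/-! ## Cross products, slopes and angles -/

/-- The cross product of two plane vectors. -/
def cross (z w : ℂ) : ℝ := z.re * w.im - z.im * w.re

/-- Twice the signed area of the triangle `abc`. -/
def orient (a b c : ℂ) : ℝ := cross (b - a) (c - a)

theorem orient_rotate (a b c : ℂ) : orient b c a = orient a b c := by
  simp only [orient, cross, Complex.sub_re, Complex.sub_im]; ring

theorem orient_swap (a b c : ℂ) : orient b a c = -orient a b c := by
  simp only [orient, cross, Complex.sub_re, Complex.sub_im]; ring

theorem cross_eq_norm_mul_sin (z w : ℂ) :
    cross z w = ‖z‖ * ‖w‖ * Real.sin (w.arg - z.arg) := by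
  rw [Real.sin_sub, cross]
  linear_combination (‖w‖ * Real.cos w.arg) * Complex.norm_mul_sin_arg z
    - (‖w‖ * Real.sin w.arg) * Complex.norm_mul_cos_arg z
    + z.im * Complex.norm_mul_cos_arg w - z.re * Complex.norm_mul_sin_arg w

theorem cross_pos_iff {z w : ℂ} (hz : z ≠ 0) (hw : w ≠ 0) :
    0 < cross z w ↔ 0 < Real.sin (w.arg - z.arg) := by
  rw [cross_eq_norm_mul_sin]
  exact mul_pos_iff_of_pos_left (mul_pos (norm_pos_iff.2 hz) (norm_pos_iff.2 hw))

theorem cross_swap (z w : ℂ) : cross w z = -cross z w := by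
  simp only [cross]; ring

theorem cross_eq_zero_iff {z w : ℂ} (hz : z ≠ 0) (hw : w ≠ 0) :
    cross z w = 0 ↔ Real.sin (w.arg - z.arg) = 0 := by
  rw [cross_eq_norm_mul_sin, mul_eq_zero, or_iff_right]
  exact (mul_pos (norm_pos_iff.2 hz) (norm_pos_iff.2 hw)).ne'

/-- Two arguments agree modulo `π` exactly when the sine of their difference vanishes, and that sine
is the cross product up to a nonzero factor. This turns all slope comparisons into polynomial
identities. -/
theorem slopeAngle_eq_iff {a b c d : ℂ} (hab : a ≠ b) (hcd : c ≠ d) :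
    slopeAngle a b = slopeAngle c d ↔ cross (b - a) (d - c) = 0 := by
  rw [cross_eq_zero_iff (sub_ne_zero.2 hab.symm) (sub_ne_zero.2 hcd.symm), slopeAngle, slopeAngle,
    toIcoMod_eq_toIcoMod, Real.sin_eq_zero_iff]
  simp only [zsmul_eq_mul]
  exact exists_congr fun n => eq_comm

/-! ### Anticlockwise turns and the cyclic order of directions -/

theorem ccwAngle_mem (z w : ℂ) : 0 < ccwAngle z w ∧ ccwAngle z w ≤ 2 * Real.pi := by
  have := toIocMod_mem_Ioc Real.two_pi_pos 0 (w.arg - z.arg)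
  rw [zero_add] at this
  exact this

theorem exists_arg_sub_eq (z w : ℂ) :
    ∃ k : ℤ, w.arg - z.arg = ccwAngle z w + k * (2 * Real.pi) :=
  ⟨toIocDiv Real.two_pi_pos 0 (w.arg - z.arg), by
    rw [← zsmul_eq_mul]; exact (toIocMod_add_toIocDiv_zsmul Real.two_pi_pos 0 _).symm⟩

theorem sin_ccwAngle (z w : ℂ) : Real.sin (ccwAngle z w) = Real.sin (w.arg - z.arg) := by
  obtain ⟨k, hk⟩ := exists_arg_sub_eq z w
  rw [hk, Real.sin_add_int_mul_two_pi]

theorem cross_pos_iff_ccwAngle {z w : ℂ} (hz : z ≠ 0) (hw : w ≠ 0) :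
    0 < cross z w ↔ ccwAngle z w < Real.pi := by
  rw [cross_pos_iff hz hw, ← sin_ccwAngle]
  obtain ⟨h0, h1⟩ := ccwAngle_mem z w
  refine ⟨fun h => ?_, Real.sin_pos_of_pos_of_lt_pi h0⟩
  by_contra! hc
  have := Real.sin_nonneg_of_nonneg_of_le_pi (x := ccwAngle z w - Real.pi) (by linarith)
    (by linarith)
  rw [Real.sin_sub_pi] at this
  linarith

theorem sin_ccwAngle_sub (z u w : ℂ) :
    Real.sin (ccwAngle z w - ccwAngle z u) = Real.sin (w.arg - u.arg) := by
  obtain ⟨k, hk⟩ := exists_arg_sub_eq z w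
  obtain ⟨l, hl⟩ := exists_arg_sub_eq z u
  have : w.arg - u.arg = (ccwAngle z w - ccwAngle z u) + ((k - l : ℤ) : ℝ) * (2 * Real.pi) := by
    push_cast; linear_combination hk - hl
  rw [this, Real.sin_add_int_mul_two_pi]

/-- The direction `u` does not precede `w` if it avoids the convex open sector from `z` to `w`. -/
theorem ccwAngle_le_of_cross_pos {z w u : ℂ} (hz : z ≠ 0) (hw : w ≠ 0) (hu : u ≠ 0)
    (hzw : 0 < cross z w) (h : ¬ (0 < cross z u ∧ 0 < cross u w)) :
    ccwAngle z w ≤ ccwAngle z u := by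
  by_contra! hlt
  rw [cross_pos_iff_ccwAngle hz hw] at hzw
  refine h ⟨(cross_pos_iff_ccwAngle hz hu).2 (hlt.trans hzw), ?_⟩
  rw [cross_pos_iff hu hw, ← sin_ccwAngle_sub z]
  exact Real.sin_pos_of_pos_of_lt_pi (by linarith) (by linarith [(ccwAngle_mem z u).1])

/-- The direction `u` does not precede `w` if it lies in the convex sector from `w` to `z`. -/
theorem ccwAngle_le_of_cross_neg {z w u : ℂ} (hz : z ≠ 0) (hw : w ≠ 0) (hu : u ≠ 0)
    (hzu : cross z u ≤ 0) (hwu : 0 ≤ cross w u) (hzw : cross z w < 0) :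
    ccwAngle z w ≤ ccwAngle z u := by
  by_contra! hlt
  have h1 : Real.pi ≤ ccwAngle z u := by
    by_contra! hc
    exact absurd ((cross_pos_iff_ccwAngle hz hu).2 hc) hzu.not_gt
  have h2 : 0 < cross u w := by
    rw [cross_pos_iff hu hw, ← sin_ccwAngle_sub z]
    -- The value `2π` stands for equal directions, where the cross product vanishes; with it
    -- excluded, the turn from `u` to `w` lies strictly between `0` and `π`.
    have h3 : ccwAngle z w ≠ 2 * Real.pi := fun hc => by
      refine hzw.ne ((cross_eq_zero_iff hz hw).2 ?_)
      rw [← sin_ccwAngle, hc, Real.sin_two_pi]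
    have := lt_of_le_of_ne (ccwAngle_mem z w).2 h3
    exact Real.sin_pos_of_pos_of_lt_pi (by linarith) (by linarith)
  rw [cross_swap w u] at h2
  linarith

/-- Turning from `z` one meets `w` no later than `u`, so the cyclic order is `u`, `z`, `w`. Since
the turn from `u` to `w` is less than `π`, `z` lies strictly inside that convex sector. This is how
the rotation at vertex `0` of the nested triangles is exploited. -/
theorem cross_pos_of_ccwAngle_le {u z w : ℂ} (hu : u ≠ 0) (hz : z ≠ 0) (hw : w ≠ 0)
    (huw : 0 < cross u w) (huz : cross u z ≠ 0)
    (h : ccwAngle z w ≤ ccwAngle z u) : 0 < cross u z ∧ 0 < cross z w := by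
  have huw' := (cross_pos_iff_ccwAngle hu hw).1 huw
  have hpi := Real.pi_pos
  obtain ⟨a0, a1⟩ := ccwAngle_mem u z
  obtain ⟨b0, b1⟩ := ccwAngle_mem u w
  obtain ⟨c0, c1⟩ := ccwAngle_mem z w
  obtain ⟨d0, d1⟩ := ccwAngle_mem z u
  have hlt : ccwAngle u z < 2 * Real.pi := by
    refine lt_of_le_of_ne a1 fun hc => huz ?_
    rw [cross_eq_zero_iff hu hz, ← sin_ccwAngle, hc, Real.sin_two_pi]
  obtain ⟨k, hk⟩ := exists_arg_sub_eq u z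
  obtain ⟨l, hl⟩ := exists_arg_sub_eq u w
  obtain ⟨m, hm⟩ := exists_arg_sub_eq z w
  obtain ⟨n, hn⟩ := exists_arg_sub_eq z u
  -- The turns there and back add up to a multiple of `2π` strictly between `0` and `4π`.
  have e1 : ccwAngle z u = 2 * Real.pi - ccwAngle u z := by
    have : ccwAngle z u + ccwAngle u z = ((-n - k : ℤ) : ℝ) * (2 * Real.pi) := by
      push_cast; linarith
    have h1 : ((-n - k : ℤ) : ℝ) < 2 := by
      by_contra! hc; nlinarith
    have h2 : (0 : ℝ) < ((-n - k : ℤ) : ℝ) := by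
      by_contra! hc; nlinarith
    have h3 : (-n - k : ℤ) = 1 := by
      have h1' : (-n - k : ℤ) < 2 := by exact_mod_cast h1
      have h2' : 0 < (-n - k : ℤ) := by exact_mod_cast h2
      omega
    rw [h3] at this
    push_cast at this; linarith
  have e2 : ccwAngle u z < ccwAngle u w := by
    by_contra! hc
    have : ccwAngle z w = ccwAngle u w - ccwAngle u z + ((l - k - m : ℤ) : ℝ) * (2 * Real.pi) := by
      push_cast; linarith
    have h1 : ((l - k - m : ℤ) : ℝ) < 1 := by
      by_contra! hc; nlinarith
    have h2 : (0 : ℝ) < ((l - k - m : ℤ) : ℝ) := by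
      by_contra! hc; nlinarith
    have h1' : (l - k - m : ℤ) < 1 := by exact_mod_cast h1
    have h2' : 0 < (l - k - m : ℤ) := by exact_mod_cast h2
    omega
  refine ⟨(cross_pos_iff_ccwAngle hu hz).2 (e2.trans huw'), ?_⟩
  rw [cross_pos_iff hz hw, ← sin_ccwAngle_sub u]
  exact Real.sin_pos_of_pos_of_lt_pi (by linarith) (by linarith)

/-- The counterpart for the rotation at vertex `1`: here the sector from `z` to `u` is known to be
convex, and `w` comes before `u` in it. -/
theorem cross_pos_of_ccwAngle_le' {u z w : ℂ} (hu : u ≠ 0) (hz : z ≠ 0) (hw : w ≠ 0)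
    (hzu : 0 < cross z u) (hwu : cross w u ≠ 0)
    (h : ccwAngle z w ≤ ccwAngle z u) : 0 < cross w u ∧ 0 < cross z w := by
  have hzu' := (cross_pos_iff_ccwAngle hz hu).1 hzu
  refine ⟨?_, (cross_pos_iff_ccwAngle hz hw).2 (h.trans_lt hzu')⟩
  have hlt : ccwAngle z w < ccwAngle z u := by
    refine lt_of_le_of_ne h fun hc => hwu ?_
    rw [cross_eq_zero_iff hw hu, ← sin_ccwAngle_sub z, hc, sub_self, Real.sin_zero]
  rw [cross_pos_iff hw hu, ← sin_ccwAngle_sub z]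
  exact Real.sin_pos_of_pos_of_lt_pi (by linarith) (by linarith [(ccwAngle_mem z w).1])

/-! ## Triangles -/

/-- The interior of a counterclockwise triangle. -/
def triInt (a b c : ℂ) : Set ℂ := {x | 0 < orient a b x ∧ 0 < orient b c x ∧ 0 < orient c a x}

theorem triInt_rotate (a b c : ℂ) : triInt b c a = triInt a b c := by
  ext x; simp only [triInt, Set.mem_ofPred_eq]; tauto

theorem orient_add_orient_add_orient (a b c x : ℂ) :
    orient a b x + orient b c x + orient c a x = orient a b c := by
  simp only [orient, cross, Complex.sub_re, Complex.sub_im]; ring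

/-- Cramer's rule: the three signed areas at `x` are its barycentric coordinates, scaled by the area
of `abc`. -/
theorem orient_smul_eq (a b c x : ℂ) :
    (orient a b c : ℂ) * x = orient b c x * a + orient c a x * b + orient a b x * c := by
  apply Complex.ext <;>
  simp only [orient, cross, Complex.sub_re, Complex.sub_im, Complex.add_re, Complex.add_im,
    Complex.mul_re, Complex.mul_im, Complex.ofReal_re, Complex.ofReal_im] <;> ring

theorem mem_segment_of_orient {a b c x : ℂ} (h : 0 < orient a b c) (h0 : orient a b x = 0)
    (h1 : 0 ≤ orient b c x) (h2 : 0 ≤ orient c a x) : x ∈ segment ℝ a b := by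
  have hs := orient_add_orient_add_orient a b c x
  have he := orient_smul_eq a b c x
  refine ⟨orient b c x / orient a b c, orient c a x / orient a b c, div_nonneg h1 h.le,
    div_nonneg h2 h.le, ?_, ?_⟩
  · rw [← add_div, div_eq_one_iff_eq h.ne']; linarith
  · have hne : (orient a b c : ℂ) ≠ 0 := by exact_mod_cast h.ne'
    rw [h0] at he
    simp only [Complex.real_smul, Complex.ofReal_div]
    field_simp
    rw [he]; push_cast; ring

theorem continuous_orient (a b : ℂ) : Continuous fun x => orient a b x := by
  unfold orient cross
  fun_prop

theorem isOpen_triInt (a b c : ℂ) : IsOpen (triInt a b c) :=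
  (isOpen_lt continuous_const (continuous_orient a b)).inter
    ((isOpen_lt continuous_const (continuous_orient b c)).inter
      (isOpen_lt continuous_const (continuous_orient c a)))

theorem orient_pos_of_mem_triInt {a b c x : ℂ} (hx : x ∈ triInt a b c) : 0 < orient a b c := by
  have := orient_add_orient_add_orient a b c x
  obtain ⟨h1, h2, h3⟩ := hx
  linarith

theorem isBounded_triInt (a b c : ℂ) : Bornology.IsBounded (triInt a b c) := by
  refine isBounded_iff_forall_norm_le.2 ⟨‖a‖ + ‖b‖ + ‖c‖, fun x hx => ?_⟩
  have hpos := orient_pos_of_mem_triInt hx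
  obtain ⟨h1, h2, h3⟩ := hx
  have hs := orient_add_orient_add_orient a b c x
  have he := congrArg norm (orient_smul_eq a b c x)
  have hle := norm_add₃_le (a := (orient b c x : ℂ) * a) (b := (orient c a x : ℂ) * b)
    (c := (orient a b x : ℂ) * c)
  rw [← he] at hle
  simp only [norm_mul, Complex.norm_real, Real.norm_of_nonneg, h1.le, h2.le, h3.le, hpos.le] at hle
  have ha := norm_nonneg a
  have hb := norm_nonneg b
  have hc := norm_nonneg c
  have : orient a b c * ‖x‖ ≤ orient a b c * (‖a‖ + ‖b‖ + ‖c‖) := by nlinarith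
  exact le_of_mul_le_mul_left this hpos

/-- The open triangle has its frontier on the three sides, which belong to `D`; a connected set that
avoids `D` and meets the interior cannot leave it. -/
theorem connectedComponentIn_subset_triInt {a b c x : ℂ} {D : Set ℂ} (hx : x ∈ triInt a b c)
    (hxD : x ∉ D) (hab : segment ℝ a b ⊆ D) (hbc : segment ℝ b c ⊆ D) (hca : segment ℝ c a ⊆ D) :
    connectedComponentIn Dᶜ x ⊆ triInt a b c := by
  have hpos := orient_pos_of_mem_triInt hx
  refine isPreconnected_connectedComponentIn.subset_of_closure_inter_subset (isOpen_triInt a b c)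
    ⟨x, mem_connectedComponentIn hxD, hx⟩ ?_
  rintro y ⟨hy, hyC⟩
  have hyD : y ∉ D := connectedComponentIn_subset _ _ hyC
  have hcl : closure (triInt a b c) ⊆
      {y | 0 ≤ orient a b y} ∩ ({y | 0 ≤ orient b c y} ∩ {y | 0 ≤ orient c a y}) :=
    closure_minimal (fun z hz => ⟨hz.1.le, hz.2.1.le, hz.2.2.le⟩)
      ((isClosed_le continuous_const (continuous_orient a b)).inter
        ((isClosed_le continuous_const (continuous_orient b c)).inter
          (isClosed_le continuous_const (continuous_orient c a))))
  obtain ⟨h1, h2, h3⟩ := hcl hy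
  refine ⟨lt_of_le_of_ne h1 fun h => ?_, lt_of_le_of_ne h2 fun h => ?_,
    lt_of_le_of_ne h3 fun h => ?_⟩
  · exact hyD (hab (mem_segment_of_orient hpos h.symm h2 h3))
  · exact hyD (hbc (mem_segment_of_orient (by rwa [orient_rotate]) h.symm h3 h1))
  · exact hyD (hca (mem_segment_of_orient (by rwa [← orient_rotate]) h.symm h1 h2))

/-- The ray from `x` along the left normal of `ab` stays in the open half-plane on the left of `ab`,
which contains no point of `D`. -/
theorem not_isBounded_connectedComponentIn {a b x : ℂ} {D : Set ℂ} (hab : a ≠ b)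
    (hD : ∀ y ∈ D, orient a b y ≤ 0) (hx : 0 < orient a b x) :
    ¬ Bornology.IsBounded (connectedComponentIn Dᶜ x) := by
  intro hb
  obtain ⟨R, hR⟩ := isBounded_iff_forall_norm_le.1 hb
  have hn : 0 < ‖b - a‖ := norm_pos_iff.2 (sub_ne_zero.2 hab.symm)
  have hor : ∀ s : ℝ, orient a b (x + s * (Complex.I * (b - a)))
      = orient a b x + s * ((b - a).re ^ 2 + (b - a).im ^ 2) := by
    intro s
    simp only [orient, cross, Complex.sub_re, Complex.sub_im, Complex.add_re, Complex.add_im,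
      Complex.mul_re, Complex.mul_im, Complex.ofReal_re, Complex.ofReal_im, Complex.I_re,
      Complex.I_im]
    ring
  have hpc : IsPreconnected ((fun s : ℝ => x + s * (Complex.I * (b - a))) '' Set.Ici 0) :=
    isPreconnected_Ici.image _ (by fun_prop)
  have hsub := hpc.subset_connectedComponentIn (F := Dᶜ) (x := x) ⟨0, Set.self_mem_Ici, by simp⟩ (by
    rintro _ ⟨s, hs, rfl⟩ hmem
    have := hD _ hmem
    rw [hor] at this
    have hs' : (0 : ℝ) ≤ s := hs
    have : 0 ≤ s * ((b - a).re ^ 2 + (b - a).im ^ 2) := by positivity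
    linarith)
  have hR0 : 0 ≤ R := (norm_nonneg x).trans (hR x (hsub ⟨0, Set.self_mem_Ici, by simp⟩))
  -- This point of the ray is at distance `R + ‖x‖ + 1` from `x`, hence of norm at least `R + 1`.
  have := hR _ (hsub ⟨(R + ‖x‖ + 1) / ‖b - a‖, by
    rw [Set.mem_Ici]; positivity, rfl⟩)
  have h2 := norm_sub_norm_le (((R + ‖x‖ + 1) / ‖b - a‖ : ℝ) * (Complex.I * (b - a))) (-x)
  rw [sub_neg_eq_add, norm_neg, add_comm _ x, norm_mul, norm_mul, Complex.norm_I, one_mul,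
    Complex.norm_real, Real.norm_of_nonneg (by positivity), div_mul_cancel₀ _ hn.ne'] at h2
  linarith

/-! ## Segments of a drawing -/

@[simp] theorem edgeSegment_mk {V : Type u} (p : V → ℂ) (x y : V) :
    edgeSegment p s(x, y) = segment ℝ (p x) (p y) := rfl

/-- Coordinates on the line with `v` at `0` and `w` at `1`. Segments with a common edge `vw` thereby
become intervals that both contain `[0, 1]`. -/
theorem segment_eq_lineMap_image {a b v w : ℂ} (hvw : v ≠ w) (hv : v ∈ segment ℝ a b)
    (hw : w ∈ segment ℝ a b) :
    ∃ α β : ℝ, α ≤ 0 ∧ 1 ≤ β ∧ segment ℝ a b = AffineMap.lineMap v w '' Set.Icc α β := by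
  have hv' := hv
  have hw' := hw
  rw [segment_eq_image_lineMap] at hv' hw'
  obtain ⟨s, -, rfl⟩ := hv'
  obtain ⟨t, -, rfl⟩ := hw'
  have hst : t - s ≠ 0 := sub_ne_zero.2 (by rintro rfl; exact hvw rfl)
  set L : ℝ →ᵃ[ℝ] ℂ := AffineMap.lineMap (AffineMap.lineMap a b s) (AffineMap.lineMap a b t)
    with hL
  have key : ∀ r : ℝ, L ((r - s) / (t - s)) = AffineMap.lineMap a b r := by
    intro r
    simp only [hL, AffineMap.lineMap_apply_module, Complex.real_smul]
    have : (t - s : ℂ) ≠ 0 := by exact_mod_cast hst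
    push_cast
    field_simp
    ring
  have h0 : L ((0 - s) / (t - s)) = a := by rw [key]; simp
  have h1 : L ((1 - s) / (t - s)) = b := by rw [key]; simp
  have hseg : segment ℝ a b = L '' Set.uIcc ((0 - s) / (t - s)) ((1 - s) / (t - s)) := by
    rw [← segment_eq_uIcc, image_segment, h0, h1]
  have hinj : Function.Injective L := AffineMap.lineMap_injective ℝ hvw
  have hm : ∀ c : ℝ, L c ∈ segment ℝ a b → c ∈ Set.uIcc ((0 - s) / (t - s)) ((1 - s) / (t - s)) := by
    rintro c hc
    rw [hseg] at hc
    exact hinj.mem_set_image.1 hc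
  have m0 := hm 0 (by rwa [hL, AffineMap.lineMap_apply_zero])
  have m1 := hm 1 (by rwa [hL, AffineMap.lineMap_apply_one])
  refine ⟨_, _, m0.1, m1.2, hseg⟩

/-- In the coordinates given by the shared edge, both segments are intervals containing `[0, 1]`, so
their union is an interval. Consequently an edge determines the maximal segment through it. -/
theorem FormsSegment.union {V : Type u} {G : SimpleGraph V} {p : V → ℂ}
    (hp : Function.Injective p) {S T : Set (Sym2 V)} (hS : FormsSegment G p S)
    (hT : FormsSegment G p T) {e : Sym2 V} (heS : e ∈ S) (heT : e ∈ T) :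
    FormsSegment G p (S ∪ T) := by
  obtain ⟨hSG, a, b, -, hab⟩ := hS
  obtain ⟨hTG, c, d, -, hcd⟩ := hT
  refine ⟨Set.union_subset hSG hTG, ?_⟩
  induction e with | _ x y
  have hxy : p x ≠ p y := fun h => (show G.Adj x y from hSG heS).ne (hp h)
  have hsubS : segment ℝ (p x) (p y) ⊆ segment ℝ a b :=
    hab ▸ Set.subset_biUnion_of_mem (u := edgeSegment p) heS
  have hsubT : segment ℝ (p x) (p y) ⊆ segment ℝ c d :=
    hcd ▸ Set.subset_biUnion_of_mem (u := edgeSegment p) heT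
  obtain ⟨α, β, h1, h2, h3⟩ := segment_eq_lineMap_image hxy (hsubS (left_mem_segment ..))
    (hsubS (right_mem_segment ..))
  obtain ⟨γ, δ, h4, h5, h6⟩ := segment_eq_lineMap_image hxy (hsubT (left_mem_segment ..))
    (hsubT (right_mem_segment ..))
  refine ⟨AffineMap.lineMap (p x) (p y) (min α γ), AffineMap.lineMap (p x) (p y) (max β δ), ?_, ?_⟩
  · refine (AffineMap.lineMap_injective ℝ hxy).ne (ne_of_lt ?_)
    calc min α γ ≤ 0 := min_le_of_left_le h1
      _ < 1 := one_pos
      _ ≤ max β δ := le_max_of_le_left h2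
  · rw [Set.biUnion_union, hab, hcd, h3, h6, ← Set.image_union,
      Set.Icc_union_Icc' (h4.trans (zero_le_one.trans h2)) (h1.trans (zero_le_one.trans h5)),
      ← segment_eq_Icc, image_segment]
    exact (min_le_of_left_le h1).trans (zero_le_one.trans (le_max_of_le_left h2))

theorem formsSegment_singleton {V : Type u} {G : SimpleGraph V} {p : V → ℂ}
    (hp : Function.Injective p) {e : Sym2 V} (he : e ∈ G.edgeSet) : FormsSegment G p {e} := by
  induction e with | _ x y
  refine ⟨Set.singleton_subset_iff.2 he, p x, p y, fun h => (show G.Adj x y from he).ne (hp h), ?_⟩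
  simp

theorem exists_maximal_formsSegment {V : Type u} [Finite V] {G : SimpleGraph V} {p : V → ℂ}
    (hp : Function.Injective p) {e : Sym2 V} (he : e ∈ G.edgeSet) :
    ∃ S, Maximal (FormsSegment G p) S ∧ e ∈ S := by
  obtain ⟨S, hS, hmax⟩ := (Set.toFinite {S | FormsSegment G p S}).exists_le_maximal
    (formsSegment_singleton hp he)
  exact ⟨S, hmax, hS (Set.mem_singleton e)⟩

theorem FormsSegment.nonempty {V : Type u} {G : SimpleGraph V} {p : V → ℂ} {S : Set (Sym2 V)}
    (hS : FormsSegment G p S) : S.Nonempty := by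
  by_contra! h
  obtain ⟨-, a, b, -, hab⟩ := hS
  have := left_mem_segment ℝ a b
  rw [← hab, h] at this
  simp at this

/-- Two edges are aligned if they share an endpoint and leave it in opposite directions. -/
def Aligned {V : Type u} (E : Set (Sym2 V)) (p : V → ℂ) (e f : Sym2 V) : Prop :=
  e ∈ E ∧ f ∈ E ∧ ∃ x y z, e = s(x, y) ∧ f = s(y, z) ∧ ∃ t : ℝ, 0 < t ∧ p z = p y + t * (p y - p x)

theorem Aligned.formsSegment {V : Type u} {G : SimpleGraph V} {p : V → ℂ}
    (hp : Function.Injective p) {e f : Sym2 V} (h : Aligned G.edgeSet p e f) :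
    FormsSegment G p {e, f} := by
  obtain ⟨he, hf, x, y, z, rfl, rfl, t, ht, hz⟩ := h
  have hxy : p x ≠ p y := fun h => (show G.Adj x y from he).ne (hp h)
  have hz' : p z = AffineMap.lineMap (p x) (p y) (1 + t) := by
    rw [hz, AffineMap.lineMap_apply_module, Complex.real_smul, Complex.real_smul]; push_cast; ring
  have h0 : p x = AffineMap.lineMap (p x) (p y) (0 : ℝ) := by simp
  have h1 : p y = AffineMap.lineMap (p x) (p y) (1 : ℝ) := by simp
  refine ⟨Set.insert_subset_iff.2 ⟨he, Set.singleton_subset_iff.2 hf⟩, p x, p z, ?_, ?_⟩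
  · rw [hz']
    nth_rw 1 [h0]
    exact (AffineMap.lineMap_injective ℝ hxy).ne (by linarith)
  · have e1 : segment ℝ (p x) (p y) = AffineMap.lineMap (p x) (p y) '' Set.Icc (0 : ℝ) 1 := by
      rw [← segment_eq_Icc zero_le_one, image_segment, ← h0, ← h1]
    have e2 : segment ℝ (p y) (p z) = AffineMap.lineMap (p x) (p y) '' Set.Icc (1 : ℝ) (1 + t) := by
      rw [← segment_eq_Icc (by linarith), image_segment, ← h1, ← hz']
    have e3 : segment ℝ (p x) (p z) = AffineMap.lineMap (p x) (p y) '' Set.Icc (0 : ℝ) (1 + t) := by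
      rw [← segment_eq_Icc (by linarith), image_segment, ← h0, ← hz']
    rw [Set.biUnion_pair, edgeSegment_mk, edgeSegment_mk, e1, e2, e3, ← Set.image_union,
      Set.Icc_union_Icc_eq_Icc zero_le_one (by linarith)]

theorem mem_iff_mem_of_aligned {V : Type u} {G : SimpleGraph V} {p : V → ℂ}
    (hp : Function.Injective p) {S : Set (Sym2 V)} (hS : Maximal (FormsSegment G p) S)
    {e f : Sym2 V} (h : Relation.EqvGen (Aligned G.edgeSet p) e f) : e ∈ S ↔ f ∈ S := by
  induction h with
  | rel e f h =>
    constructor <;> intro hm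
    · exact hS.le_of_ge (hS.prop.union hp (h.formsSegment hp) hm (by simp)) Set.subset_union_left
        (by simp)
    · exact hS.le_of_ge (hS.prop.union hp (h.formsSegment hp) hm (by simp)) Set.subset_union_left
        (by simp)
  | refl => rfl
  | symm _ _ _ ih => exact ih.symm
  | trans _ _ _ _ _ ih1 ih2 => exact ih1.trans ih2

theorem numSegments_eq_card {V : Type u} (G : SimpleGraph V) (p : V → ℂ) :
    numSegments G p = Nat.card {S : Set (Sym2 V) // Maximal (FormsSegment G p) S} := by
  rw [numSegments, ← Nat.card_coe_set_eq]; rfl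

/-- Maximality makes a segment absorb every edge aligned with one of its own, so each segment
contains an element of `R`; two segments with a common element coincide, whence an injection into
`R`. -/
theorem numSegments_le_card {V : Type u} [Finite V] {G : SimpleGraph V} {p : V → ℂ}
    (hp : Function.Injective p) (R : Finset (Sym2 V))
    (hR : ∀ e ∈ G.edgeSet, ∃ r ∈ R, Relation.EqvGen (Aligned G.edgeSet p) e r) :
    numSegments G p ≤ R.card := by
  classical
  have hch : ∀ S : {S : Set (Sym2 V) // Maximal (FormsSegment G p) S}, ∃ r ∈ R, r ∈ S.1 := by
    rintro ⟨S, hS⟩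
    obtain ⟨e, he⟩ := hS.prop.nonempty
    obtain ⟨r, hr, her⟩ := hR e (hS.prop.1 he)
    exact ⟨r, hr, (mem_iff_mem_of_aligned hp hS her).1 he⟩
  choose g hgR hg using hch
  have hinj : Function.Injective fun S => (⟨g S, hgR S⟩ : R) := by
    rintro ⟨S, hS⟩ ⟨T, hT⟩ h
    have h' : g ⟨S, hS⟩ = g ⟨T, hT⟩ := congrArg Subtype.val h
    have hu := hS.prop.union hp hT.prop (hg ⟨S, hS⟩) (h' ▸ hg ⟨T, hT⟩)
    exact Subtype.ext ((hS.eq_of_subset hu Set.subset_union_left).trans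
      (hT.eq_of_subset hu Set.subset_union_right).symm)
  have := Nat.card_le_card_of_injective _ hinj
  rwa [Nat.card_eq_fintype_card (α := R), Fintype.card_coe, ← numSegments_eq_card] at this

theorem slopeAngle_eq_of_mem_segment {a b x y z w : ℂ} (hx : x ∈ segment ℝ a b)
    (hy : y ∈ segment ℝ a b) (hz : z ∈ segment ℝ a b) (hw : w ∈ segment ℝ a b) (hxy : x ≠ y)
    (hzw : z ≠ w) : slopeAngle x y = slopeAngle z w := by
  rw [slopeAngle_eq_iff hxy hzw]
  rw [segment_eq_image_lineMap] at hx hy hz hw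
  obtain ⟨s1, -, rfl⟩ := hx
  obtain ⟨s2, -, rfl⟩ := hy
  obtain ⟨s3, -, rfl⟩ := hz
  obtain ⟨s4, -, rfl⟩ := hw
  simp only [cross, AffineMap.lineMap_apply_module, Complex.real_smul, Complex.sub_re,
    Complex.sub_im, Complex.add_re, Complex.add_im, Complex.mul_re, Complex.mul_im,
    Complex.ofReal_re, Complex.ofReal_im]
  ring

theorem numSlopes_le_numSegments {V : Type u} [Finite V] {G : SimpleGraph V} {p : V → ℂ}
    (hp : Function.Injective p) : numSlopes G p ≤ numSegments G p := by
  classical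
  have hch : ∀ S : {S : Set (Sym2 V) // Maximal (FormsSegment G p) S},
      ∃ d : G.Dart, d.edge ∈ S.1 := by
    rintro ⟨S, hS⟩
    obtain ⟨e, he⟩ := hS.prop.nonempty
    induction e with | _ x y
    exact ⟨⟨(x, y), hS.prop.1 he⟩, he⟩
  choose g hg using hch
  have hsub : (Set.range fun d : G.Dart => slopeAngle (p d.fst) (p d.snd)) ⊆
      Set.range fun S => slopeAngle (p (g S).fst) (p (g S).snd) := by
    rintro _ ⟨d, rfl⟩
    obtain ⟨S, hS, hd⟩ := exists_maximal_formsSegment hp d.edge_mem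
    refine ⟨⟨S, hS⟩, ?_⟩
    obtain ⟨-, a, b, -, hab⟩ := hS.prop
    have hsub : ∀ d : G.Dart, d.edge ∈ S → segment ℝ (p d.fst) (p d.snd) ⊆ segment ℝ a b :=
      fun d hd => hab ▸ Set.subset_biUnion_of_mem (u := edgeSegment p) hd
    have h1 := hsub _ (hg ⟨S, hS⟩)
    have h2 := hsub _ hd
    exact slopeAngle_eq_of_mem_segment (h1 (left_mem_segment ..)) (h1 (right_mem_segment ..))
      (h2 (left_mem_segment ..)) (h2 (right_mem_segment ..))
      (hp.ne (g ⟨S, hS⟩).fst_ne_snd) (hp.ne d.fst_ne_snd)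
  refine (Set.ncard_le_ncard hsub (Set.toFinite _)).trans ?_
  rw [← Set.image_univ]
  refine (Set.ncard_image_le (Set.toFinite _)).trans ?_
  rw [Set.ncard_univ, numSegments_eq_card]

/-! ## `3`-trees -/

/-- `BuiltFrom G T S`: the vertex set `S` arises from `T` by repeatedly adding a vertex whose
neighbours among the previous vertices form a triangle of `G`. -/
inductive BuiltFrom {V : Type u} (G : SimpleGraph V) (T : Set V) : Set V → Prop
  | base : BuiltFrom G T T
  | step {S : Set V} {v a b c : V} (hS : BuiltFrom G T S) (hv : v ∉ S) (ha : a ∈ S) (hb : b ∈ S)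
      (hc : c ∈ S) (hab : G.Adj a b) (hbc : G.Adj b c) (hca : G.Adj c a)
      (hadj : ∀ x ∈ S, G.Adj v x ↔ x = a ∨ x = b ∨ x = c) : BuiltFrom G T (insert v S)

theorem BuiltFrom.subset {V : Type u} {G : SimpleGraph V} {T S : Set V} (h : BuiltFrom G T S) :
    T ⊆ S := by
  induction h with
  | base => rfl
  | step _ _ _ _ _ _ _ _ _ ih => exact ih.trans (Set.subset_insert _ _)

theorem BuiltFrom.image_val {V : Type u} {G : SimpleGraph V} {s : Set V} {T S : Set s}
    (h : BuiltFrom (G.induce s) T S) : BuiltFrom G (Subtype.val '' T) (Subtype.val '' S) := by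
  induction h with
  | base => exact .base
  | @step S v a b c _ hv ha hb hc hab hbc hca hadj ih =>
    rw [Set.image_insert_eq]
    refine .step ih ?_ (Set.mem_image_of_mem _ ha) (Set.mem_image_of_mem _ hb)
      (Set.mem_image_of_mem _ hc) hab hbc hca ?_
    · rintro ⟨x, hx, hxv⟩
      exact hv (Subtype.ext hxv ▸ hx)
    · rintro _ ⟨x, hx, rfl⟩
      simpa [Subtype.ext_iff] using hadj x hx

/-- Change of the starting triangle: from `{v, a, b}` add `c`, then repeat the given construction.
Its later vertices lie outside `{a, b, c}` and so are not adjacent to `v`, whose presence does not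
disturb the steps. -/
theorem BuiltFrom.insert_vertex {V : Type u} {G : SimpleGraph V} {S : Set V} {v a b c : V}
    (hab : G.Adj a b) (hbc : G.Adj b c) (hca : G.Adj c a)
    (hadj : ∀ x, G.Adj v x ↔ x = a ∨ x = b ∨ x = c)
    (h : BuiltFrom G {a, b, c} S) (hv : v ∉ S) : BuiltFrom G {v, a, b} (insert v S) := by
  induction h with
  | base =>
    have : insert v ({a, b, c} : Set V) = insert c {v, a, b} := by
      ext x; simp only [Set.mem_insert_iff, Set.mem_singleton_iff]; tauto
    rw [this]
    have hva := (hadj a).2 (.inl rfl)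
    have hvb := (hadj b).2 (.inr (.inl rfl))
    have hvc := (hadj c).2 (.inr (.inr rfl))
    refine .step (a := v) (b := a) (c := b) .base ?_ (by simp) (by simp) (by simp) hva hab hvb.symm ?_
    · simp [hvc.ne', hca.ne, hbc.ne']
    · simp only [Set.mem_insert_iff, Set.mem_singleton_iff]
      rintro x hx
      refine ⟨fun _ => hx, ?_⟩
      rintro (rfl | rfl | rfl)
      exacts [hvc.symm, hca, hbc.symm]
  | @step S w d e f hS hw hd he hf hde hef hfd hadj' ih =>
    rw [Set.mem_insert_iff, not_or] at hv
    rw [Set.insert_comm v w]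
    have hsub := hS.subset
    refine .step (ih hv.2) ?_ (.inr hd) (.inr he) (.inr hf) hde hef hfd ?_
    · rw [Set.mem_insert_iff, not_or]
      exact ⟨Ne.symm hv.1, hw⟩
    · rintro x (rfl | hx)
      · constructor
        · intro h
          refine absurd ?_ hw
          apply hsub
          simpa using (hadj w).1 h.symm
        · rintro (h | h | h)
          exacts [absurd (h ▸ hd) hv.2, absurd (h ▸ he) hv.2, absurd (h ▸ hf) hv.2]
      · exact hadj' x hx

theorem ncard_eq_three_of_isClique {V : Type u} {G : SimpleGraph V} {s : Set V}
    (hs : G.IsClique s) (hcard : s.ncard = 3) :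
    ∃ a b c, G.Adj a b ∧ G.Adj b c ∧ G.Adj c a ∧ ∀ x, x ∈ s ↔ x = a ∨ x = b ∨ x = c := by
  obtain ⟨a, b, c, hab, hac, hbc, rfl⟩ := Set.ncard_eq_three.1 hcard
  exact ⟨a, b, c, hs (by simp) (by simp) hab, hs (by simp) (by simp) hbc,
    hs (by simp) (by simp) hac.symm, by simp⟩

/-- The outerface may be any face, so the construction has to start from an arbitrary triangle. If
the last vertex `v` of the recursive definition is not in the triangle, it is added last; otherwise
the triangle is `v` with two of its neighbours and `BuiltFrom.insert_vertex` applies. -/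
theorem IsKTree.builtFrom {V : Type u} {G : SimpleGraph V} (h : IsKTree 3 G) {A B C : V}
    (hAB : G.Adj A B) (hBC : G.Adj B C) (hCA : G.Adj C A) :
    BuiltFrom G {A, B, C} Set.univ := by
  induction h with
  | @complete V hcard =>
    have : Finite V := Nat.finite_of_card_ne_zero (by omega)
    have hT : ({A, B, C} : Set V).ncard = 3 :=
      Set.ncard_eq_three.2 ⟨A, B, C, hAB.ne, hCA.ne', hBC.ne, rfl⟩
    have hc := Set.ncard_add_ncard_compl ({A, B, C} : Set V)
    rw [hT, hcard] at hc
    obtain ⟨v, hv⟩ := Set.ncard_eq_one.1 (show ({A, B, C} : Set V)ᶜ.ncard = 1 by omega)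
    have hvT : v ∉ ({A, B, C} : Set V) := by
      rw [← Set.mem_compl_iff, hv]; rfl
    have : (Set.univ : Set V) = insert v {A, B, C} := by
      rw [← Set.singleton_union, ← hv, Set.compl_union_self]
    rw [this]
    refine .step .base hvT (by simp) (by simp) (by simp) hAB hBC hCA fun x hx => ?_
    rw [SimpleGraph.top_adj]
    exact ⟨fun _ => hx, fun _ h => hvT (h ▸ hx)⟩
  | @extend V G v hclique hdeg _ ih =>
    obtain ⟨a, b, c, hab, hbc, hca, hN⟩ := ncard_eq_three_of_isClique hclique hdeg
    simp only [SimpleGraph.mem_neighborSet] at hN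
    have hva := (hN a).2 (.inl rfl)
    have hvb := (hN b).2 (.inr (.inl rfl))
    have hvc := (hN c).2 (.inr (.inr rfl))
    have key : ∀ {x y z : V}, x ≠ v → y ≠ v → z ≠ v → G.Adj x y → G.Adj y z → G.Adj z x →
        BuiltFrom G {x, y, z} {v}ᶜ := by
      intro x y z hx hy hz hxy hyz hzx
      have := (@ih ⟨x, hx⟩ ⟨y, hy⟩ ⟨z, hz⟩ hxy hyz hzx).image_val
      rwa [Set.image_insert_eq, Set.image_insert_eq, Set.image_singleton, Set.image_univ,
        Subtype.range_coe] at this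
    have huniv : (Set.univ : Set V) = insert v {v}ᶜ := by
      rw [← Set.singleton_union, Set.union_compl_self]
    rw [huniv]
    have hvv : v ∉ ({v}ᶜ : Set V) := by simp
    have hin : ∀ {y z : V}, G.Adj v y → G.Adj v z → G.Adj y z →
        BuiltFrom G {v, y, z} (insert v {v}ᶜ) := by
      intro y z hy hz hyz
      have hab' := key hva.ne' hvb.ne' hvc.ne' hab hbc hca
      have hbc' : BuiltFrom G {b, c, a} {v}ᶜ := key hvb.ne' hvc.ne' hva.ne' hbc hca hab
      have hca' : BuiltFrom G {c, a, b} {v}ᶜ := key hvc.ne' hva.ne' hvb.ne' hca hab hbc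
      have r1 := BuiltFrom.insert_vertex hab hbc hca hN hab' hvv
      have r2 := BuiltFrom.insert_vertex hbc hca hab (fun x => (hN x).trans (by tauto)) hbc' hvv
      have r3 := BuiltFrom.insert_vertex hca hab hbc (fun x => (hN x).trans (by tauto)) hca' hvv
      rcases (hN y).1 hy with rfl | rfl | rfl <;> rcases (hN z).1 hz with rfl | rfl | rfl
      · exact (hyz.ne rfl).elim
      · exact r1
      · rwa [Set.pair_comm] at r3
      · rwa [Set.pair_comm] at r1
      · exact (hyz.ne rfl).elim
      · exact r2
      · exact r3
      · rwa [Set.pair_comm] at r2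
      · exact (hyz.ne rfl).elim
    by_cases hA : A = v
    · subst hA
      exact hin hAB hCA.symm hBC
    by_cases hB : B = v
    · subst hB
      rw [show ({A, B, C} : Set V) = {B, C, A} by
        ext x; simp only [Set.mem_insert_iff, Set.mem_singleton_iff]; tauto]
      exact hin hBC hAB.symm hCA
    by_cases hC : C = v
    · subst hC
      rw [show ({A, B, C} : Set V) = {C, A, B} by
        ext x; simp only [Set.mem_insert_iff, Set.mem_singleton_iff]; tauto]
      exact hin hCA hBC.symm hAB
    refine .step (key hA hB hC hAB hBC hCA) hvv hva.ne' hvb.ne' hvc.ne' hab hbc hca fun x _ => hN x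

/-- Provides a second neighbour for each endpoint of an edge, which rules out faces of length two.
-/
theorem IsKTree.exists_common_neighbor {V : Type u} {G : SimpleGraph V} (h : IsKTree 3 G)
    {x y : V} (hxy : G.Adj x y) : ∃ z, G.Adj x z ∧ G.Adj y z := by
  induction h with
  | @complete V hcard =>
    have : Finite V := Nat.finite_of_card_ne_zero (by omega)
    have hc := Set.ncard_add_ncard_compl ({x, y} : Set V)
    rw [Set.ncard_pair hxy.ne, hcard] at hc
    obtain ⟨z, hz⟩ := Set.nonempty_of_ncard_ne_zero (s := ({x, y} : Set V)ᶜ) (by omega)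
    simp only [Set.mem_compl_iff, Set.mem_insert_iff, Set.mem_singleton_iff, not_or] at hz
    exact ⟨z, Ne.symm hz.1, Ne.symm hz.2⟩
  | @extend V G v hclique hdeg _ ih =>
    obtain ⟨a, b, c, hab, hbc, hca, hN⟩ := ncard_eq_three_of_isClique hclique hdeg
    simp only [SimpleGraph.mem_neighborSet] at hN
    have hva := (hN a).2 (.inl rfl)
    have hvb := (hN b).2 (.inr (.inl rfl))
    have hvc := (hN c).2 (.inr (.inr rfl))
    have key : ∀ {y}, G.Adj v y → ∃ z, G.Adj v z ∧ G.Adj y z := by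
      intro y hy
      rcases (hN y).1 hy with rfl | rfl | rfl
      exacts [⟨b, hvb, hab⟩, ⟨c, hvc, hbc⟩, ⟨a, hva, hca⟩]
    by_cases hx : x = v
    · subst hx; exact key hxy
    by_cases hy : y = v
    · subst hy
      obtain ⟨z, h1, h2⟩ := key hxy.symm
      exact ⟨z, h2, h1⟩
    obtain ⟨z, h1, h2⟩ := @ih ⟨x, hx⟩ ⟨y, hy⟩ hxy
    exact ⟨z, h1, h2⟩

theorem IsKTree.card_edgeSet {V : Type u} {G : SimpleGraph V} (h : IsKTree 3 G) [Finite V] :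
    Nat.card G.edgeSet + 6 = 3 * Nat.card V := by
  classical
  revert ‹Finite V›
  induction h with
  | @complete V hcard =>
    intro hfin
    have := Fintype.ofFinite V
    rw [Nat.card_eq_fintype_card] at hcard ⊢
    rw [Nat.card_eq_fintype_card, ← SimpleGraph.edgeFinset_card,
      SimpleGraph.card_edgeFinset_top_eq_card_choose_two, hcard]
    decide
  | @extend V G v hclique hdeg _ ih =>
    intro hfin
    have := Fintype.ofFinite V
    have hi := ih
    have h1 := G.card_edgeFinset_induce_compl_singleton v
    have h2 := G.card_edgeFinset_deleteIncidenceSet v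
    have h3 : G.degree v = 3 := by
      rw [← hdeg, ← SimpleGraph.card_neighborSet_eq_degree, ← Nat.card_eq_fintype_card,
        Nat.card_coe_set_eq]
    have h4 : G.degree v ≤ G.edgeFinset.card := by
      rw [← SimpleGraph.card_incidenceFinset_eq_degree]
      exact Finset.card_le_card (G.incidenceFinset_subset v)
    rw [Nat.card_eq_fintype_card, ← SimpleGraph.edgeFinset_card] at hi ⊢
    have h5 : Nat.card ({v}ᶜ : Set V) + 1 = Nat.card V := by
      rw [Nat.card_coe_set_eq, ← Set.ncard_add_ncard_compl ({v} : Set V), Set.ncard_singleton,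
        add_comm]
    have h6 : (G.induce {v}ᶜ).edgeFinset.card = G.edgeFinset.card - 3 := by
      rw [h1, h2, h3]
    omega

/-! ## Faces of triangulations -/

/-! ### Permutations whose cycles have length three -/

section Perm

variable {α : Type u} (σ : Equiv.Perm α)

theorem card_eq_sum_card_sameCycle [Fintype α] [Fintype (Quotient (Equiv.Perm.SameCycle.setoid σ))] :
    Fintype.card α = ∑ q : Quotient (Equiv.Perm.SameCycle.setoid σ),
      {x | Quotient.mk (Equiv.Perm.SameCycle.setoid σ) x = q}.ncard := by
  classical
  rw [← Finset.card_univ, Finset.card_eq_sum_card_fiberwise (t := Finset.univ)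
    (f := Quotient.mk (Equiv.Perm.SameCycle.setoid σ)) (fun _ _ => Finset.mem_coe.2 (Finset.mem_univ _))]
  refine Finset.sum_congr rfl fun q _ => ?_
  rw [← Set.ncard_coe_finset]
  congr 1
  ext x; simp

variable {σ}

theorem triple_subset_cycle (x : α) :
    {x, σ x, σ (σ x)} ⊆ {y | Quotient.mk (Equiv.Perm.SameCycle.setoid σ) y = Quotient.mk _ x} := by
  rintro y (rfl | rfl | rfl)
  · rfl
  · exact Quotient.sound (show σ.SameCycle _ _ by simp [Equiv.Perm.SameCycle.refl])
  · exact Quotient.sound (show σ.SameCycle _ _ by simp [Equiv.Perm.SameCycle.refl])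

theorem ncard_triple (h1 : ∀ x, σ x ≠ x) (h2 : ∀ x, σ (σ x) ≠ x) (x : α) :
    ({x, σ x, σ (σ x)} : Set α).ncard = 3 :=
  Set.ncard_eq_three.2 ⟨x, σ x, σ (σ x), (h1 x).symm, (h2 x).symm, (h1 _).symm, rfl⟩

theorem sameCycle_mem_triple (h3 : ∀ x, σ (σ (σ x)) = x) {x y : α} (h : σ.SameCycle x y) :
    y = x ∨ y = σ x ∨ y = σ (σ x) := by
  obtain ⟨i, hi⟩ := h
  have hz : σ ^ (3 : ℤ) = 1 := by ext z; exact h3 z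
  have hmod : (σ ^ (i % 3)) x = y := by
    rw [← hi]
    conv_rhs => rw [← Int.mul_ediv_add_emod i 3, zpow_add, zpow_mul, hz, one_zpow, one_mul]
  have hlt := Int.emod_lt_of_pos i (show (0 : ℤ) < 3 by norm_num)
  have hnn := Int.emod_nonneg i (show (3 : ℤ) ≠ 0 by norm_num)
  generalize i % 3 = j at *
  interval_cases j
  · exact .inl hmod.symm
  · exact .inr (.inl (by rw [← hmod]; rfl))
  · exact .inr (.inr (by rw [← hmod]; rfl))

theorem three_mul_card_sameCycle [Finite α] (h1 : ∀ x, σ x ≠ x) (h3 : ∀ x, σ (σ (σ x)) = x) :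
    3 * Nat.card (Quotient (Equiv.Perm.SameCycle.setoid σ)) = Nat.card α := by
  classical
  have := Fintype.ofFinite α
  have := Fintype.ofFinite (Quotient (Equiv.Perm.SameCycle.setoid σ))
  have h2 : ∀ x, σ (σ x) ≠ x := fun x h => h1 x (by have := h3 x; rwa [h] at this)
  rw [Nat.card_eq_fintype_card, Nat.card_eq_fintype_card, card_eq_sum_card_sameCycle σ,
    Finset.sum_congr rfl (g := fun _ => 3), Finset.sum_const, Finset.card_univ, smul_eq_mul,
    mul_comm]
  rintro q -
  induction q using Quotient.inductionOn with | _ x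
  rw [← ncard_triple h1 h2 x]
  congr 1
  refine (triple_subset_cycle x).antisymm' ?_
  intro y hy
  exact sameCycle_mem_triple h3 (Quotient.exact hy).symm

/-- Every cycle has at least three elements and the average length is at most three, so all lengths
equal three. -/
theorem apply_apply_apply_eq_of_card [Finite α] (h1 : ∀ x, σ x ≠ x) (h2 : ∀ x, σ (σ x) ≠ x)
    (hcard : Nat.card α ≤ 3 * Nat.card (Quotient (Equiv.Perm.SameCycle.setoid σ))) (x : α) :
    σ (σ (σ x)) = x := by
  classical
  have := Fintype.ofFinite α
  have := Fintype.ofFinite (Quotient (Equiv.Perm.SameCycle.setoid σ))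
  rw [Nat.card_eq_fintype_card, Nat.card_eq_fintype_card, card_eq_sum_card_sameCycle σ,
    mul_comm, ← smul_eq_mul, ← Finset.card_univ, ← Finset.sum_const] at hcard
  have hge : ∀ q ∈ (Finset.univ : Finset (Quotient (Equiv.Perm.SameCycle.setoid σ))),
      3 ≤ {x | Quotient.mk (Equiv.Perm.SameCycle.setoid σ) x = q}.ncard := by
    rintro q -
    induction q using Quotient.inductionOn with | _ x
    rw [← ncard_triple h1 h2 x]
    exact Set.ncard_le_ncard (triple_subset_cycle x) (Set.toFinite _)
  have heq := (Finset.sum_eq_sum_iff_of_le hge).1 ((Finset.sum_le_sum hge).antisymm hcard)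
    (Quotient.mk _ x) (Finset.mem_univ _)
  have hset := Set.eq_of_subset_of_ncard_le (triple_subset_cycle (σ := σ) x)
    (by rw [← heq, ncard_triple h1 h2 x]) (Set.toFinite _)
  have hmem : σ (σ (σ x)) ∈ ({x, σ x, σ (σ x)} : Set α) := by
    rw [hset]
    exact Quotient.sound (show σ.SameCycle _ _ by simp [Equiv.Perm.SameCycle.refl])
  rcases hmem with h | h | h
  · exact h
  · exact absurd (σ.injective h) (h2 x)
  · exact absurd h (h1 _)

end Perm

instance finite_dart {V : Type u} [Finite V] (G : SimpleGraph V) : Finite G.Dart :=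
  Finite.of_injective (fun d => d.toProd) fun _ _ h => SimpleGraph.Dart.ext _ _ h

theorem card_dart {V : Type u} [Finite V] (G : SimpleGraph V) :
    Nat.card G.Dart = 2 * Nat.card G.edgeSet := by
  classical
  have := Fintype.ofFinite V
  rw [Nat.card_eq_fintype_card, Nat.card_eq_fintype_card, G.dart_card_eq_twice_card_edges,
    SimpleGraph.edgeFinset_card]

namespace RotationSystem

variable {V : Type u} {G : SimpleGraph V} (R : RotationSystem G)

theorem faceNext_apply (d : G.Dart) : R.faceNext d = R.rot.symm d.symm := rfl

theorem fst_rot_symm (d : G.Dart) : (R.rot.symm d).fst = d.fst := by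
  rw [← R.fst_rot (R.rot.symm d), Equiv.apply_symm_apply]

theorem fst_faceNext (d : G.Dart) : (R.faceNext d).fst = d.snd := R.fst_rot_symm d.symm

theorem faceNext_ne (d : G.Dart) : R.faceNext d ≠ d := fun h =>
  d.fst_ne_snd (by rw [← R.fst_faceNext d, h])

/-- In a face of length two the rotation fixes `d.symm`; being transitive at the head of `d`, it
would leave that vertex with a single neighbour. -/
theorem faceNext_faceNext_ne
    (hdeg : ∀ x y, G.Adj x y → ∃ z, G.Adj x z ∧ z ≠ y) (d : G.Dart) :
    R.faceNext (R.faceNext d) ≠ d := by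
  intro h
  have h1 := R.fst_faceNext d
  have h2 := R.fst_faceNext (R.faceNext d)
  rw [h] at h2
  have h3 : R.faceNext d = d.symm := by
    ext
    · exact h1
    · exact h2.symm
  have hfix : R.rot d.symm = d.symm := by
    rw [faceNext_apply] at h3
    exact (Equiv.symm_apply_eq _).1 h3 |>.symm
  obtain ⟨z, hz, hne⟩ := hdeg d.snd d.fst d.adj.symm
  have := (R.sameCycle_rot d.symm ⟨(d.snd, z), hz⟩ rfl).eq_of_left hfix
  exact hne (congrArg (fun e : G.Dart => e.snd) this).symm

/-- `R.IsFace a b c`: the edge that follows `ab` anticlockwise around `a` is `ac`. In a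
triangulation this means that `abc` is the face to the left of `ab`. -/
def IsFace (a b c : V) : Prop :=
  ∃ (hab : G.Adj a b) (hac : G.Adj a c), R.rot ⟨(a, b), hab⟩ = ⟨(a, c), hac⟩

end RotationSystem

/-- A triangulation on the vertex set `S`, given by its facial triangles. -/
structure FaceSystem {V : Type u} (G : SimpleGraph V) (S : Set V) (F : V → V → V → Prop) :
    Prop where
  rotate : ∀ {a b c}, F a b c → F b c a
  adj : ∀ {a b c}, F a b c → G.Adj a b
  mem : ∀ {a b c}, F a b c → a ∈ S
  exists_third : ∀ {a b}, a ∈ S → b ∈ S → G.Adj a b → ∃ c, F a b c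
  unique : ∀ {a b c d}, F a b c → F a b d → c = d

theorem RotationSystem.faceSystem {V : Type u} {G : SimpleGraph V} (R : RotationSystem G)
    (h3 : ∀ d, R.faceNext (R.faceNext (R.faceNext d)) = d) :
    FaceSystem G Set.univ R.IsFace where
  rotate := by
    rintro a b c ⟨hab, hac, h⟩
    have e1 : R.faceNext ⟨(c, a), hac.symm⟩ = ⟨(a, b), hab⟩ := by
      rw [faceNext_apply, Equiv.symm_apply_eq, h]; rfl
    have e2 := h3 ⟨(c, a), hac.symm⟩
    rw [e1] at e2
    set d := R.faceNext ⟨(a, b), hab⟩ with hd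
    have f1 : d.fst = b := R.fst_faceNext _
    have f2 : d.snd = c := by rw [← R.fst_faceNext, e2]
    have hbc : G.Adj b c := by have := d.adj; rwa [f1, f2] at this
    have e3 : d = ⟨(b, c), hbc⟩ := by ext <;> assumption
    refine ⟨hbc, hab.symm, ?_⟩
    rw [← e3, hd, faceNext_apply, Equiv.apply_symm_apply]; rfl
  adj := by rintro a b c ⟨hab, -, -⟩; exact hab
  mem := fun _ => Set.mem_univ _
  exists_third := by
    intro a b _ _ hab
    have := R.fst_rot ⟨(a, b), hab⟩
    have h2 : G.Adj a (R.rot ⟨(a, b), hab⟩).snd := by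
      have h := (R.rot ⟨(a, b), hab⟩).adj
      rwa [this] at h
    exact ⟨_, hab, h2, by ext <;> [exact this; rfl]⟩
  unique := by
    rintro a b c d ⟨hab, hac, h⟩ ⟨_, had, h'⟩
    rw [h] at h'
    exact congrArg (fun e : G.Dart => e.snd) h'

/-- `(x, y, z)` is a rotation of `(a, b, c)`. -/
def IsRotation {V : Type u} (a b c x y z : V) : Prop :=
  (x = a ∧ y = b ∧ z = c) ∨ (x = b ∧ y = c ∧ z = a) ∨ (x = c ∧ y = a ∧ z = b)

theorem IsRotation.rotate {V : Type u} {a b c x y z : V} (h : IsRotation a b c x y z) :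
    IsRotation a b c y z x := by
  unfold IsRotation at *; tauto

/-! ### Deleting a vertex of degree three from a triangulation -/

namespace FaceSystem

variable {V : Type u} {G : SimpleGraph V} {S : Set V} {F : V → V → V → Prop}

theorem of_isRotation (hF : FaceSystem G S F) {a b c x y z : V} (h : F a b c)
    (hr : IsRotation a b c x y z) : F x y z := by
  rcases hr with ⟨rfl, rfl, rfl⟩ | ⟨rfl, rfl, rfl⟩ | ⟨rfl, rfl, rfl⟩
  exacts [h, hF.rotate h, hF.rotate (hF.rotate h)]

/-- The faces left after deleting a vertex `v` whose link is the triangle `abc`. -/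
def removed (F : V → V → V → Prop) (v a b c : V) (x y z : V) : Prop :=
  (F x y z ∧ x ≠ v ∧ y ≠ v ∧ z ≠ v) ∨ IsRotation a b c x y z

/-- Sending `x` to the third vertex of the face on `vx` is an injective map of `{a, b, c}` to itself
without fixed points, hence a `3`-cycle; the value at `a` decides which one. -/
theorem link_of_face {v a b c : V} (hF : FaceSystem G (insert v S) F)
    (hb : b ∈ S) (hc : c ∈ S) (hbc : G.Adj b c) (hca : G.Adj c a)
    (hadj : ∀ x ∈ S, G.Adj v x ↔ x = a ∨ x = b ∨ x = c) (h : F v a b) :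
    F v b c ∧ F v c a := by
  have hthird : ∀ {x}, x ∈ S → G.Adj v x → ∃ y, F v x y ∧ (y = a ∨ y = b ∨ y = c) := by
    intro x hx hvx
    obtain ⟨y, hy⟩ := hF.exists_third (.inl rfl) (.inr hx) hvx
    have hadjy := hF.adj (hF.rotate (hF.rotate hy))
    have hyS : y ∈ S := (hF.mem (hF.rotate (hF.rotate hy))).resolve_left hadjy.ne
    exact ⟨y, hy, (hadj y hyS).1 hadjy.symm⟩
  have hinj : ∀ {x x' y}, F v x y → F v x' y → x = x' := fun h h' =>
    hF.unique (hF.rotate (hF.rotate h)) (hF.rotate (hF.rotate h'))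
  have hne : ∀ {x y}, F v x y → x ≠ y := fun h => (hF.adj (hF.rotate h)).ne
  obtain ⟨y, hy, hy'⟩ := hthird hb ((hadj b hb).2 (by simp))
  obtain ⟨z, hz, hz'⟩ := hthird hc ((hadj c hc).2 (by simp))
  have hza : z = a := by
    rcases hz' with rfl | rfl | rfl
    · rfl
    · exact absurd (hinj hz h) hca.ne
    · exact absurd rfl (hne hz)
  subst hza
  rcases hy' with rfl | rfl | rfl
  · exact absurd (hinj hy hz) hbc.ne
  · exact absurd rfl (hne hy)
  · exact ⟨hy, hz⟩

theorem face_of_mem_link {v a b c : V} (hF : FaceSystem G (insert v S) F)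
    (hadj : ∀ x ∈ S, G.Adj v x ↔ x = a ∨ x = b ∨ x = c)
    (h1 : F v a b) (h2 : F v b c) (h3 : F v c a) {y z : V} (h : F v y z) :
    (y = a ∧ z = b) ∨ (y = b ∧ z = c) ∨ (y = c ∧ z = a) := by
  have hvy := hF.adj h
  have hy : y ∈ S := (hF.mem (hF.rotate h)).resolve_left hvy.ne'
  rcases (hadj y hy).1 hvy with rfl | rfl | rfl
  · exact .inl ⟨rfl, hF.unique h h1⟩
  · exact .inr (.inl ⟨rfl, hF.unique h h2⟩)
  · exact .inr (.inr ⟨rfl, hF.unique h h3⟩)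

theorem face_cases {v a b c : V} (hF : FaceSystem G (insert v S) F)
    (hadj : ∀ x ∈ S, G.Adj v x ↔ x = a ∨ x = b ∨ x = c)
    (h1 : F v a b) (h2 : F v b c) (h3 : F v c a) {x y z : V} (h : F x y z) :
    (x ≠ v ∧ y ≠ v ∧ z ≠ v) ∨ IsRotation a b v x y z ∨ IsRotation b c v x y z ∨
      IsRotation c a v x y z := by
  have key := fun {y z : V} (h : F v y z) => face_of_mem_link hF hadj h1 h2 h3 h
  by_cases hx : x = v
  · subst hx
    rcases key h with ⟨rfl, rfl⟩ | ⟨rfl, rfl⟩ | ⟨rfl, rfl⟩ <;> simp [IsRotation]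
  by_cases hy : y = v
  · subst hy
    rcases key (hF.rotate h) with ⟨rfl, rfl⟩ | ⟨rfl, rfl⟩ | ⟨rfl, rfl⟩ <;> simp [IsRotation]
  by_cases hz : z = v
  · subst hz
    rcases key (hF.rotate (hF.rotate h)) with ⟨rfl, rfl⟩ | ⟨rfl, rfl⟩ | ⟨rfl, rfl⟩ <;>
      simp [IsRotation]
  exact .inl ⟨hx, hy, hz⟩

/-- In `F` the third vertex over each directed side of `abc` is `v`. Hence the new face `abc` fills
exactly the places that the faces at `v` leave vacant and competes with no surviving face. -/
theorem remove {v a b c : V} (hF : FaceSystem G (insert v S) F) (hv : v ∉ S)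
    (ha : a ∈ S) (hb : b ∈ S) (hc : c ∈ S) (hab : G.Adj a b) (hbc : G.Adj b c) (hca : G.Adj c a)
    (hadj : ∀ x ∈ S, G.Adj v x ↔ x = a ∨ x = b ∨ x = c)
    (h1 : F v a b) (h2 : F v b c) (h3 : F v c a) : FaceSystem G S (removed F v a b c) where
  rotate := by
    rintro x y z (⟨h, hx, hy, hz⟩ | h)
    · exact .inl ⟨hF.rotate h, hy, hz, hx⟩
    · exact .inr h.rotate
  adj := by
    rintro x y z (⟨h, -⟩ | ⟨rfl, rfl, rfl⟩ | ⟨rfl, rfl, rfl⟩ | ⟨rfl, rfl, rfl⟩)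
    exacts [hF.adj h, hab, hbc, hca]
  mem := by
    rintro x y z (⟨h, hx, -⟩ | ⟨rfl, rfl, rfl⟩ | ⟨rfl, rfl, rfl⟩ | ⟨rfl, rfl, rfl⟩)
    exacts [(hF.mem h).resolve_left hx, ha, hb, hc]
  exists_third := by
    intro x y hx hy hxy
    obtain ⟨z, hz⟩ := hF.exists_third (.inr hx) (.inr hy) hxy
    have hxv : x ≠ v := fun h => hv (h ▸ hx)
    have hyv : y ≠ v := fun h => hv (h ▸ hy)
    by_cases hzv : z = v
    · subst hzv
      rcases face_of_mem_link hF hadj h1 h2 h3 (hF.rotate (hF.rotate hz)) with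
        ⟨rfl, rfl⟩ | ⟨rfl, rfl⟩ | ⟨rfl, rfl⟩
      · exact ⟨c, .inr (by simp [IsRotation])⟩
      · exact ⟨a, .inr (by simp [IsRotation])⟩
      · exact ⟨b, .inr (by simp [IsRotation])⟩
    · exact ⟨z, .inl ⟨hz, hxv, hyv, hzv⟩⟩
  unique := by
    have key : ∀ {x y z w}, F x y z → z ≠ v → IsRotation a b c x y w → False := by
      rintro x y z w h hz (⟨rfl, rfl, rfl⟩ | ⟨rfl, rfl, rfl⟩ | ⟨rfl, rfl, rfl⟩)
      exacts [hz (hF.unique h (hF.rotate h1)), hz (hF.unique h (hF.rotate h2)),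
        hz (hF.unique h (hF.rotate h3))]
    rintro x y z w (⟨h, hx, hy, hz⟩ | h) (⟨h', hx', hy', hz'⟩ | h')
    · exact hF.unique h h'
    · exact (key h hz h').elim
    · exact (key h' hz' h).elim
    · rcases h with ⟨rfl, rfl, rfl⟩ | ⟨rfl, rfl, rfl⟩ | ⟨rfl, rfl, rfl⟩ <;>
        rcases h' with ⟨h4, h5, h6⟩ | ⟨h4, h5, h6⟩ | ⟨h4, h5, h6⟩ <;> simp_all

end FaceSystem

/-- Euler's formula with `3n - 6` edges makes the number of darts equal to three times the number of
faces. -/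
theorem PlaneEmbedding.faceNext_faceNext_faceNext {V : Type u} [Fintype V] {G : SimpleGraph V}
    (P : PlaneEmbedding G) (hG : IsKTree 3 G) (d : G.Dart) :
    P.faceNext (P.faceNext (P.faceNext d)) = d := by
  refine apply_apply_apply_eq_of_card P.faceNext_ne (P.faceNext_faceNext_ne fun x y hxy => ?_) ?_ d
  · obtain ⟨z, h1, h2⟩ := hG.exists_common_neighbor hxy
    exact ⟨z, h1, h2.ne'⟩
  · have h1 := hG.card_edgeSet
    have h2 := card_dart G
    have h3 := P.euler
    have h4 : Nat.card V = Fintype.card V := Nat.card_eq_fintype_card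
    change _ ≤ 3 * Nat.card P.toRotationSystem.Face
    omega

/-! ## Geometry of a point in a triangle -/

theorem orient_affine (A B a b c x : ℂ) :
    orient a b c * orient A B x =
      orient b c x * orient A B a + orient c a x * orient A B b + orient a b x * orient A B c := by
  simp only [orient, cross, Complex.sub_re, Complex.sub_im]; ring

theorem orient_self_left (a b : ℂ) : orient a b a = 0 := by
  simp only [orient, cross, Complex.sub_re, Complex.sub_im]; ring

theorem orient_self_right (a b : ℂ) : orient a b b = 0 := by
  simp only [orient, cross, Complex.sub_re, Complex.sub_im]; ring

theorem orient_combo (A B a b : ℂ) {s t : ℝ} (hst : s + t = 1) :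
    orient A B (s • a + t • b) = s * orient A B a + t * orient A B b := by
  obtain rfl : s = 1 - t := by linarith
  simp only [orient, cross, Complex.sub_re, Complex.sub_im, Complex.add_re, Complex.add_im,
    Complex.real_smul, Complex.mul_re, Complex.mul_im, Complex.ofReal_re, Complex.ofReal_im]
  ring

theorem orient_eq_zero_of_mem_segment {a b y : ℂ} (hy : y ∈ segment ℝ a b) : orient a b y = 0 := by
  obtain ⟨s, t, -, -, hst, rfl⟩ := hy
  rw [orient_combo _ _ _ _ hst, orient_self_left, orient_self_right]; ring

theorem eq_of_orient_eq_zero {u x y q : ℂ} (h1 : orient u x q = 0) (h2 : orient u y q = 0)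
    (h : orient u x y ≠ 0) : q = u := by
  have h3 : orient y u q = 0 := by rw [orient_swap, h2, neg_zero]
  have hs := orient_add_orient_add_orient u x y q
  have he := orient_smul_eq u x y q
  rw [h1, h3] at he hs
  have : orient x y q = orient u x y := by linarith
  rw [this] at he
  have hne : (orient u x y : ℂ) ≠ 0 := by exact_mod_cast h
  exact mul_left_cancel₀ hne (by simpa using he)

theorem triInt_subset {a b c q : ℂ} (hq : q ∈ triInt a b c) : triInt a b q ⊆ triInt a b c := by
  intro x hx
  have h0 := orient_pos_of_mem_triInt hq
  have hq0 := orient_pos_of_mem_triInt hx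
  obtain ⟨q1, q2, q3⟩ := hq
  obtain ⟨h1, h2, h3⟩ := hx
  refine ⟨h1, ?_, ?_⟩
  · have := orient_affine b c a b q x
    rw [orient_self_left, orient_rotate a b c] at this
    exact pos_of_mul_pos_right (by rw [this]; nlinarith [mul_pos h2 h0, mul_pos h1 q2]) hq0.le
  · have := orient_affine c a a b q x
    rw [orient_self_right, ← orient_rotate c a b] at this
    exact pos_of_mul_pos_right (by rw [this]; nlinarith [mul_pos h3 h0, mul_pos h1 q3]) hq0.le

theorem mem_triInt_or_eq_of_mem_segment {a b c q y : ℂ} (hq : q ∈ triInt a b c)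
    (hy : y ∈ segment ℝ q a) : y ∈ triInt a b c ∨ y = a := by
  have h0 := orient_pos_of_mem_triInt hq
  obtain ⟨q1, q2, q3⟩ := hq
  obtain ⟨s, t, hs, ht, hst, rfl⟩ := hy
  rcases hs.eq_or_lt with rfl | hs
  · right; obtain rfl : t = 1 := by linarith
    simp
  · left
    refine ⟨?_, ?_, ?_⟩
    · rw [orient_combo _ _ _ _ hst, orient_self_left]; nlinarith [mul_pos hs q1]
    · rw [orient_combo _ _ _ _ hst, orient_rotate a b c]; nlinarith [mul_pos hs q2]
    · rw [orient_combo _ _ _ _ hst, orient_self_right]; nlinarith [mul_pos hs q3]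

theorem not_mem_triInt_of_mem_segment {a b q y : ℂ} (hy : y ∈ segment ℝ q a) :
    y ∉ triInt a b q := fun h => by
  have := orient_eq_zero_of_mem_segment hy
  exact h.2.2.ne' this

theorem not_mem_triInt_of_mem_segment_right {a b q y : ℂ} (hy : y ∈ segment ℝ q b) :
    y ∉ triInt a b q := fun h => by
  have := orient_eq_zero_of_mem_segment hy
  rw [orient_swap] at this
  linarith [h.2.1]

theorem not_mem_triInt_of_mem_segment_opposite {a b c q y : ℂ} (hq : q ∈ triInt a b c)
    (hy : y ∈ segment ℝ q a) : y ∉ triInt b c q := fun h => by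
  obtain ⟨s, t, hs, ht, hst, rfl⟩ := hy
  have h1 := h.2.1
  rw [orient_combo _ _ _ _ hst, orient_self_right, ← orient_rotate c q a,
    ← orient_rotate q a c, orient_swap] at h1
  have h3 := hq.2.2
  nlinarith [mul_nonneg ht h3.le]

theorem triInt_disjoint {a b c q y : ℂ} (h : y ∈ triInt a b q) : y ∉ triInt b c q := fun h' => by
  have h1 := h.2.1
  have h2 := h'.2.2
  rw [orient_swap] at h2
  linarith

/-- A vertex placed inside a face makes all three new faces extendable: the edge from each corner,
prolonged beyond the new vertex, enters the opposite face. -/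
theorem exists_extension {a b c q : ℂ} (hq : q ∈ triInt a b c) :
    ∃ t : ℝ, 0 < t ∧ q + t * (q - c) ∈ triInt a b q := by
  have h0 := orient_pos_of_mem_triInt hq
  obtain ⟨q1, q2, q3⟩ := hq
  -- With this `t`, the signed area over `ab` at the prolonged point is exactly `t * orient a b q`.
  have ht : 0 < orient a b q / orient a b c := div_pos q1 h0
  refine ⟨_, ht, ?_, ?_, ?_⟩
  · have : orient a b (q + (orient a b q / orient a b c : ℝ) * (q - c)) =
        orient a b q + (orient a b q / orient a b c) * (orient a b q - orient a b c) := by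
      simp only [orient, cross, Complex.sub_re, Complex.sub_im, Complex.add_re, Complex.add_im,
        Complex.mul_re, Complex.mul_im, Complex.ofReal_re, Complex.ofReal_im]; ring
    rw [this, mul_sub, div_mul_cancel₀ _ h0.ne']
    nlinarith
  · have : ∀ t : ℝ, orient b q (q + t * (q - c)) = t * orient b c q := by
      intro t
      simp only [orient, cross, Complex.sub_re, Complex.sub_im, Complex.add_re, Complex.add_im,
        Complex.mul_re, Complex.mul_im, Complex.ofReal_re, Complex.ofReal_im]; ring
    rw [this]; positivity
  · have : ∀ t : ℝ, orient q a (q + t * (q - c)) = t * orient c a q := by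
      intro t
      simp only [orient, cross, Complex.sub_re, Complex.sub_im, Complex.add_re, Complex.add_im,
        Complex.mul_re, Complex.mul_im, Complex.ofReal_re, Complex.ofReal_im]; ring
    rw [this]; positivity

theorem triInt_nonempty {a b c : ℂ} (h : 0 < orient a b c) : (triInt a b c).Nonempty := by
  refine ⟨(a + b + c) / 3, ?_, ?_, ?_⟩ <;>
  · have e : ∀ A B : ℂ, orient A B ((a + b + c) / 3) =
        (orient A B a + orient A B b + orient A B c) / 3 := by
      intro A B
      simp only [orient, cross, Complex.sub_re, Complex.sub_im, Complex.add_re, Complex.add_im,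
        Complex.div_ofNat_re, Complex.div_ofNat_im]; ring
    rw [e]
    have h1 := orient_rotate a b c
    have h2 := orient_rotate b c a
    simp only [orient_self_left, orient_self_right]
    linarith

theorem orient_of_isRotation {V : Type u} {p : V → ℂ} {a b c x y z : V}
    (h : IsRotation a b c x y z) : orient (p x) (p y) (p z) = orient (p a) (p b) (p c) := by
  rcases h with ⟨rfl, rfl, rfl⟩ | ⟨rfl, rfl, rfl⟩ | ⟨rfl, rfl, rfl⟩
  · rfl
  · rw [orient_rotate]
  · rw [← orient_rotate]

theorem triInt_of_isRotation {V : Type u} {p : V → ℂ} {a b c x y z : V}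
    (h : IsRotation a b c x y z) : triInt (p x) (p y) (p z) = triInt (p a) (p b) (p c) := by
  rcases h with ⟨rfl, rfl, rfl⟩ | ⟨rfl, rfl, rfl⟩ | ⟨rfl, rfl, rfl⟩
  · rfl
  · rw [triInt_rotate]
  · rw [← triInt_rotate]

/-! ## Drawing a stacked triangulation -/

/-- A plane drawing `p` of the subgraph of `G` induced by `S`, with inner faces `I` and with
clockwise outer triangle `ABC`. -/
structure PartialDrawing {V : Type u} (G : SimpleGraph V) (A B C : V) (S : Set V)
    (I : V → V → V → Prop) (p : V → ℂ) : Prop where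
  outer_neg : orient (p A) (p B) (p C) < 0
  inner_pos : ∀ {a b c}, I a b c → 0 < orient (p a) (p b) (p c)
  mem_outer : ∀ {x}, x ∈ S → orient (p A) (p B) (p x) ≤ 0 ∧ orient (p B) (p C) (p x) ≤ 0 ∧
    orient (p C) (p A) (p x) ≤ 0
  vertex_disjoint : ∀ {a b c x}, I a b c → x ∈ S → p x ∉ triInt (p a) (p b) (p c)
  edge_disjoint : ∀ {a b c x y q}, I a b c → x ∈ S → y ∈ S → G.Adj x y →
    q ∈ segment ℝ (p x) (p y) → q ∉ triInt (p a) (p b) (p c)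
  face_disjoint : ∀ {a b c x y z q}, I a b c → I x y z → q ∈ triInt (p a) (p b) (p c) →
    q ∈ triInt (p x) (p y) (p z) → IsRotation a b c x y z
  injOn : Set.InjOn p S
  vertex_edge : ∀ {x y z}, x ∈ S → y ∈ S → G.Adj x y → z ∈ S → p z ∈ segment ℝ (p x) (p y) →
    z = x ∨ z = y
  edge_edge : ∀ {x y z w q}, x ∈ S → y ∈ S → G.Adj x y → z ∈ S → w ∈ S → G.Adj z w →
    q ∈ segment ℝ (p x) (p y) → q ∈ segment ℝ (p z) (p w) →
    s(x, y) = s(z, w) ∨ ∃ u, (u = x ∨ u = y) ∧ (u = z ∨ u = w) ∧ q = p u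

namespace PartialDrawing

variable {V : Type u} {G : SimpleGraph V} {A B C : V} {S : Set V} {I J : V → V → V → Prop}
  {p : V → ℂ}

/-- Allows the position of a vertex outside `S` to be reset before that vertex is inserted. -/
theorem congr {p' : V → ℂ} (h : PartialDrawing G A B C S I p) (hA : A ∈ S) (hB : B ∈ S)
    (hC : C ∈ S) (hI : ∀ {a b c}, I a b c → a ∈ S ∧ b ∈ S ∧ c ∈ S)
    (hp : ∀ x ∈ S, p' x = p x) : PartialDrawing G A B C S I p' where
  outer_neg := by rw [hp A hA, hp B hB, hp C hC]; exact h.outer_neg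
  inner_pos := by
    intro a b c hf
    obtain ⟨h1, h2, h3⟩ := hI hf
    rw [hp a h1, hp b h2, hp c h3]; exact h.inner_pos hf
  mem_outer := by
    intro x hx
    rw [hp A hA, hp B hB, hp C hC, hp x hx]; exact h.mem_outer hx
  vertex_disjoint := by
    intro a b c x hf hx
    obtain ⟨h1, h2, h3⟩ := hI hf
    rw [hp a h1, hp b h2, hp c h3, hp x hx]; exact h.vertex_disjoint hf hx
  edge_disjoint := by
    intro a b c x y q hf hx hy
    obtain ⟨h1, h2, h3⟩ := hI hf
    rw [hp a h1, hp b h2, hp c h3, hp x hx, hp y hy]; exact h.edge_disjoint hf hx hy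
  face_disjoint := by
    intro a b c x y z q hf hf'
    obtain ⟨h1, h2, h3⟩ := hI hf
    obtain ⟨h4, h5, h6⟩ := hI hf'
    rw [hp a h1, hp b h2, hp c h3, hp x h4, hp y h5, hp z h6]; exact h.face_disjoint hf hf'
  injOn := fun x hx y hy hxy => h.injOn hx hy (by rwa [hp x hx, hp y hy] at hxy)
  vertex_edge := by
    intro x y z hx hy hxy hz
    rw [hp x hx, hp y hy, hp z hz]; exact h.vertex_edge hx hy hxy hz
  edge_edge := by
    intro x y z w q hx hy hxy hz hw hzw
    rw [hp x hx, hp y hy, hp z hz, hp w hw]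
    intro h1 h2
    rcases h.edge_edge hx hy hxy hz hw hzw h1 h2 with h3 | ⟨u, h3, h4, h5⟩
    · exact .inl h3
    · refine .inr ⟨u, h3, h4, ?_⟩
      rw [h5, hp u]
      rcases h3 with rfl | rfl <;> assumption

/-- The drawing of a triangle. -/
theorem triangle (hp : orient (p A) (p B) (p C) < 0) (hAB : A ≠ B) (hBC : B ≠ C) (hCA : C ≠ A)
    (hI : ∀ {a b c}, I a b c → IsRotation A C B a b c) :
    PartialDrawing G A B C {A, B, C} I p := by
  have hpos : 0 < orient (p A) (p C) (p B) := by
    rw [← orient_rotate, orient_swap, orient_rotate]; linarith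
  have hside : ∀ {x y z}, x ∈ ({A, B, C} : Set V) → y ∈ ({A, B, C} : Set V) →
      z ∈ ({A, B, C} : Set V) → x ≠ y → y ≠ z → z ≠ x → orient (p x) (p y) (p z) ≠ 0 := by
    have h1 := orient_rotate (p A) (p B) (p C)
    have h2 := orient_rotate (p B) (p C) (p A)
    have h4 := orient_rotate (p A) (p C) (p B)
    have h5 := orient_rotate (p C) (p B) (p A)
    rintro x y z (rfl | rfl | rfl) (rfl | rfl | rfl) (rfl | rfl | rfl) hxy hyz hzx <;>
      first | exact absurd rfl hxy | exact absurd rfl hyz | exact absurd rfl hzx | skip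
    all_goals first | (apply ne_of_gt; linarith) | (apply ne_of_lt; linarith)
  have hedge : ∀ {a b c x y q}, I a b c → x ∈ ({A, B, C} : Set V) → y ∈ ({A, B, C} : Set V) →
      x ≠ y → q ∈ segment ℝ (p x) (p y) → q ∉ triInt (p a) (p b) (p c) := by
    intro a b c x y q hf hx hy hxy hq hmem
    rw [triInt_of_isRotation (hI hf)] at hmem
    obtain ⟨m1, m2, m3⟩ := hmem
    have h0 := orient_eq_zero_of_mem_segment hq
    have h1 := orient_swap (p A) (p B) q
    have h2 := orient_swap (p B) (p C) q
    have h3 := orient_swap (p C) (p A) q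
    rcases hx with rfl | rfl | rfl <;> rcases hy with rfl | rfl | rfl <;>
      first | exact absurd rfl hxy | linarith
  have hinj : Set.InjOn p {A, B, C} := by
    have key : ∀ {x y}, x ∈ ({A, B, C} : Set V) → y ∈ ({A, B, C} : Set V) → x ≠ y → p x ≠ p y := by
      intro x y hx hy hxy h
      have : ∃ z ∈ ({A, B, C} : Set V), y ≠ z ∧ z ≠ x := by
        rcases hx with rfl | rfl | rfl <;> rcases hy with rfl | rfl | rfl <;>
          first | exact absurd rfl hxy | skip
        exacts [⟨C, by simp, hBC, hCA⟩, ⟨B, by simp, hBC.symm, hAB.symm⟩,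
          ⟨C, by simp, hCA.symm, hBC.symm⟩, ⟨A, by simp, hCA, hAB⟩,
          ⟨B, by simp, hAB, hBC⟩, ⟨A, by simp, hAB.symm, hCA.symm⟩]
      obtain ⟨z, hz, h1, h2⟩ := this
      refine hside hx hy hz hxy h1 h2 ?_
      rw [h]; simp [orient, cross]
    intro x hx y hy h
    by_contra hxy
    exact key hx hy hxy h
  refine ⟨hp, ?_, ?_, ?_, ?_, ?_, hinj, ?_, ?_⟩
  · intro a b c hf
    rw [orient_of_isRotation (hI hf)]; exact hpos
  · have h1 := orient_rotate (p A) (p B) (p C)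
    have h2 := orient_rotate (p B) (p C) (p A)
    rintro x (rfl | rfl | rfl) <;> simp only [orient_self_left, orient_self_right] <;>
      refine ⟨?_, ?_, ?_⟩ <;> linarith
  · intro a b c x hf hx
    have : ∃ y ∈ ({A, B, C} : Set V), x ≠ y := by
      rcases hx with rfl | rfl | rfl
      exacts [⟨B, by simp, hAB⟩, ⟨C, by simp, hBC⟩, ⟨A, by simp, hCA⟩]
    obtain ⟨y, hy, hxy⟩ := this
    exact hedge hf hx hy hxy (left_mem_segment ..)
  · intro a b c x y q hf hx hy hxy
    exact hedge hf hx hy hxy.ne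
  · intro a b c x y z q hf hf' _ _
    have h1 := hI hf
    have h2 := hI hf'
    clear hf hf'
    unfold IsRotation at *
    rcases h1 with ⟨rfl, rfl, rfl⟩ | ⟨rfl, rfl, rfl⟩ | ⟨rfl, rfl, rfl⟩ <;> tauto
  · intro x y z hx hy hxy hz hmem
    by_contra! hc
    exact hside hx hy hz hxy.ne hc.2.symm hc.1 (orient_eq_zero_of_mem_segment hmem)
  · intro x y z w q hx hy hxy hz hw hzw h1 h2
    by_cases hE : s(x, y) = s(z, w)
    · exact .inl hE
    right
    have key : ∀ {u x y}, u ∈ ({A, B, C} : Set V) → x ∈ ({A, B, C} : Set V) →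
        y ∈ ({A, B, C} : Set V) → u ≠ x → u ≠ y → x ≠ y → q ∈ segment ℝ (p u) (p x) →
        q ∈ segment ℝ (p u) (p y) → q = p u := fun hu hx hy hux huy hxy h1 h2 =>
      eq_of_orient_eq_zero (orient_eq_zero_of_mem_segment h1) (orient_eq_zero_of_mem_segment h2)
        (hside hu hx hy hux hxy huy.symm)
    have h1' := h1
    have h2' := h2
    rw [segment_symm] at h1' h2'
    by_cases e1 : x = z
    · subst e1
      exact ⟨x, .inl rfl, .inl rfl, key hx hy hw hxy.ne hzw.ne (by rintro rfl; exact hE rfl) h1 h2⟩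
    by_cases e2 : x = w
    · subst e2
      exact ⟨x, .inl rfl, .inr rfl, key hx hy hz hxy.ne hzw.ne'
        (by rintro rfl; exact hE Sym2.eq_swap) h1 h2'⟩
    by_cases e3 : y = z
    · subst e3
      exact ⟨y, .inr rfl, .inl rfl, key hy hx hw hxy.ne' hzw.ne e2 h1' h2⟩
    by_cases e4 : y = w
    · subst e4
      exact ⟨y, .inr rfl, .inr rfl, key hy hx hz hxy.ne' hzw.ne' e1 h1' h2'⟩
    -- Two edges with four different endpoints do not fit on three vertices.
    exfalso
    have n1 := hxy.ne
    have n2 := hzw.ne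
    rcases hx with rfl | rfl | rfl <;> rcases hy with rfl | rfl | rfl <;>
      rcases hz with rfl | rfl | rfl <;> first | contradiction | skip
    all_goals rcases hw with rfl | rfl | rfl <;> contradiction

end PartialDrawing

theorem IsRotation.symm_trans {V : Type u} {a b c x y z x' y' z' : V} (h : IsRotation a b c x y z)
    (h' : IsRotation a b c x' y' z') : IsRotation x y z x' y' z' := by
  rcases h with ⟨rfl, rfl, rfl⟩ | ⟨rfl, rfl, rfl⟩ | ⟨rfl, rfl, rfl⟩ <;>
    unfold IsRotation at * <;> tauto

namespace PartialDrawing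

variable {V : Type u} {G : SimpleGraph V} {A B C : V} {S : Set V} {I J : V → V → V → Prop}
  {p : V → ℂ} {v a b c : V}

/-- Placing a new vertex `v` inside the face `abc`. -/
theorem insert_vertex (h : PartialDrawing G A B C S J p) (hv : v ∉ S) (ha : a ∈ S) (hb : b ∈ S)
    (hc : c ∈ S) (hab : G.Adj a b) (hbc : G.Adj b c) (hca : G.Adj c a)
    (hadj : ∀ x ∈ S, G.Adj v x ↔ x = a ∨ x = b ∨ x = c) (hJ : J a b c)
    (hpv : p v ∈ triInt (p a) (p b) (p c))
    (hI : ∀ {x y z}, I x y z → (J x y z ∧ ¬ IsRotation a b c x y z) ∨ IsRotation a b v x y z ∨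
      IsRotation b c v x y z ∨ IsRotation c a v x y z) :
    PartialDrawing G A B C (insert v S) I p := by
  have r2 : triInt (p b) (p c) (p a) = triInt (p a) (p b) (p c) := triInt_rotate _ _ _
  have r3 : triInt (p c) (p a) (p b) = triInt (p a) (p b) (p c) := by rw [triInt_rotate, triInt_rotate]
  have hpv2 : p v ∈ triInt (p b) (p c) (p a) := by rwa [r2]
  have hpv3 : p v ∈ triInt (p c) (p a) (p b) := by rwa [r3]
  obtain ⟨o1, o2, o3⟩ := id hpv
  -- classification of the new faces
  have hnew : ∀ {x y z}, I x y z → (J x y z ∧ ¬ IsRotation a b c x y z) ∨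
      (∃ d e f, (IsRotation a b c d e f) ∧ IsRotation d e v x y z) := by
    intro x y z hf
    rcases hI hf with h1 | h1 | h1 | h1
    · exact .inl h1
    · exact .inr ⟨a, b, c, by simp [IsRotation], h1⟩
    · exact .inr ⟨b, c, a, by simp [IsRotation], h1⟩
    · exact .inr ⟨c, a, b, by simp [IsRotation], h1⟩
  have hsub : ∀ {d e f x y z}, IsRotation a b c d e f → IsRotation d e v x y z →
      triInt (p x) (p y) (p z) ⊆ triInt (p a) (p b) (p c) := by
    intro d e f x y z h1 h2
    rw [triInt_of_isRotation h2, ← triInt_of_isRotation h1]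
    exact triInt_subset (by rwa [triInt_of_isRotation h1])
  -- Old faces other than `abc` are disjoint from its interior, where everything new happens.
  have hold : ∀ {x y z q}, J x y z → ¬ IsRotation a b c x y z → q ∈ triInt (p a) (p b) (p c) →
      q ∉ triInt (p x) (p y) (p z) := fun hf hr hq hq' => hr (h.face_disjoint hJ hf hq hq')
  -- Except for its old endpoint, a new edge lies in the open face `abc`, which contains no vertex
  -- and no point of an old edge.
  have hedge : ∀ {u y}, u ∈ S → G.Adj v u → y ∈ segment ℝ (p v) (p u) →
      y ∈ triInt (p a) (p b) (p c) ∨ y = p u := by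
    intro u y hu huv hy
    rcases (hadj u hu).1 huv with rfl | rfl | rfl
    · exact mem_triInt_or_eq_of_mem_segment hpv hy
    · rw [← r2]; exact mem_triInt_or_eq_of_mem_segment hpv2 hy
    · rw [← r3]; exact mem_triInt_or_eq_of_mem_segment hpv3 hy
  have hnewedge : ∀ {x y z u q}, I x y z → u ∈ S → G.Adj v u → q ∈ segment ℝ (p v) (p u) →
      q ∉ triInt (p x) (p y) (p z) := by
    intro x y z u q hf hu huv hq hmem
    rcases hnew hf with ⟨h1, h2⟩ | ⟨d, e, f, h1, h2⟩
    · rcases hedge hu huv hq with h3 | rfl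
      · exact hold h1 h2 h3 hmem
      · exact h.vertex_disjoint h1 hu hmem
    · rw [triInt_of_isRotation h2] at hmem
      have hcases : u = d ∨ u = e ∨ u = f := by
        have := (hadj u hu).1 huv
        rcases h1 with ⟨rfl, rfl, rfl⟩ | ⟨rfl, rfl, rfl⟩ | ⟨rfl, rfl, rfl⟩ <;> tauto
      have hpd : p v ∈ triInt (p d) (p e) (p f) := by rwa [triInt_of_isRotation h1]
      rcases hcases with rfl | rfl | rfl
      · exact not_mem_triInt_of_mem_segment hq hmem
      · exact not_mem_triInt_of_mem_segment_right hq hmem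
      · rw [← triInt_rotate, ← triInt_rotate] at hpd
        exact not_mem_triInt_of_mem_segment_opposite hpd hq hmem
  have hvert : ∀ {x}, x ∈ S → p x ≠ p v := fun hx heq =>
    h.vertex_disjoint hJ hx (heq ▸ hpv)
  have hvmem : ∀ {x y z}, I x y z → p v ∉ triInt (p x) (p y) (p z) := fun hf =>
    hnewedge hf ha ((hadj a ha).2 (.inl rfl)) (left_mem_segment ..)
  refine ⟨h.outer_neg, ?_, ?_, ?_, ?_, ?_, ?_, ?_, ?_⟩
  · intro x y z hf
    rcases hI hf with ⟨h1, -⟩ | h1 | h1 | h1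
    · exact h.inner_pos h1
    all_goals rw [orient_of_isRotation h1]; assumption
  · rintro x (rfl | hx)
    · have h0 := orient_pos_of_mem_triInt hpv
      have ha' := h.mem_outer ha
      have hb' := h.mem_outer hb
      have hc' := h.mem_outer hc
      -- The new vertex is a convex combination of `a`, `b`, `c`, so it satisfies every half-plane
      -- condition that they satisfy.
      have key : ∀ P Q : ℂ, orient P Q (p a) ≤ 0 → orient P Q (p b) ≤ 0 → orient P Q (p c) ≤ 0 →
          orient P Q (p x) ≤ 0 := by
        intro P Q h1 h2 h3
        have := orient_affine P Q (p a) (p b) (p c) (p x)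
        by_contra! hcon
        nlinarith [mul_pos h0 hcon, mul_nonneg_of_nonpos_of_nonpos (neg_nonpos.2 o2.le) h1,
          mul_nonneg_of_nonpos_of_nonpos (neg_nonpos.2 o3.le) h2,
          mul_nonneg_of_nonpos_of_nonpos (neg_nonpos.2 o1.le) h3]
      exact ⟨key _ _ ha'.1 hb'.1 hc'.1, key _ _ ha'.2.1 hb'.2.1 hc'.2.1,
        key _ _ ha'.2.2 hb'.2.2 hc'.2.2⟩
    · exact h.mem_outer hx
  · rintro x y z w hf (rfl | hw)
    · exact hvmem hf
    · intro hmem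
      rcases hnew hf with ⟨h1, -⟩ | ⟨d, e, f, h1, h2⟩
      · exact h.vertex_disjoint h1 hw hmem
      · exact h.vertex_disjoint hJ hw (hsub h1 h2 hmem)
  · rintro x y z w w' q hf (rfl | hw) (rfl | hw') hadj' hq hmem
    · exact hadj'.ne rfl
    · exact hnewedge hf hw' hadj' hq hmem
    · rw [segment_symm] at hq
      exact hnewedge hf hw hadj'.symm hq hmem
    · rcases hnew hf with ⟨h1, -⟩ | ⟨d, e, f, h1, h2⟩
      · exact h.edge_disjoint h1 hw hw' hadj' hq hmem
      · exact h.edge_disjoint hJ hw hw' hadj' hq (hsub h1 h2 hmem)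
  · intro x y z x' y' z' q hf hf' hq hq'
    rcases hnew hf with ⟨h1, h1'⟩ | ⟨d, e, f, h1, h2⟩ <;>
      rcases hnew hf' with ⟨h3, h3'⟩ | ⟨d', e', f', h3, h4⟩
    · exact h.face_disjoint h1 h3 hq hq'
    · exact absurd hq (hold h1 h1' (hsub h3 h4 hq'))
    · exact absurd hq' (hold h3 h3' (hsub h1 h2 hq))
    · rw [triInt_of_isRotation h2] at hq
      rw [triInt_of_isRotation h4] at hq'
      rcases h1 with ⟨rfl, rfl, rfl⟩ | ⟨rfl, rfl, rfl⟩ | ⟨rfl, rfl, rfl⟩ <;>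
        rcases h3 with ⟨rfl, rfl, rfl⟩ | ⟨rfl, rfl, rfl⟩ | ⟨rfl, rfl, rfl⟩ <;>
        first
        | exact h2.symm_trans h4
        | exact absurd hq' (triInt_disjoint hq)
        | exact absurd hq (triInt_disjoint hq')
  · rintro x (rfl | hx) y (rfl | hy) hxy
    · rfl
    · exact absurd hxy.symm (hvert hy)
    · exact absurd hxy (hvert hx)
    · exact h.injOn hx hy hxy
  · have key : ∀ {u z}, u ∈ S → G.Adj v u → z ∈ insert v S → p z ∈ segment ℝ (p v) (p u) →
        z = v ∨ z = u := by
      rintro u z hu huv (rfl | hz) hmem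
      · exact .inl rfl
      · rcases hedge hu huv hmem with h1 | h1
        · exact absurd h1 (h.vertex_disjoint hJ hz)
        · exact .inr (h.injOn hz hu h1)
    rintro x y z (rfl | hx) (rfl | hy) hxy hz hmem
    · exact absurd rfl hxy.ne
    · exact key hy hxy hz hmem
    · rw [segment_symm] at hmem
      exact (key hx hxy.symm hz hmem).symm
    · rcases hz with rfl | hz
      · exact absurd hpv (h.edge_disjoint hJ hx hy hxy hmem)
      · exact h.vertex_edge hx hy hxy hz hmem
  · have key : ∀ {u x y q}, u ∈ S → G.Adj v u → x ∈ S → y ∈ S → G.Adj x y →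
        q ∈ segment ℝ (p v) (p u) → q ∈ segment ℝ (p x) (p y) → (u = x ∨ u = y) ∧ q = p u := by
      intro u x y q hu huv hx hy hxy hq hq'
      rcases hedge hu huv hq with h1 | rfl
      · exact absurd h1 (h.edge_disjoint hJ hx hy hxy hq')
      · exact ⟨h.vertex_edge hx hy hxy hu hq', rfl⟩
    -- Two different new edges are not collinear, hence meet only at `v`.
    have hne : ∀ {u u'}, u ∈ S → u' ∈ S → G.Adj v u → G.Adj v u' → u ≠ u' →
        orient (p v) (p u) (p u') ≠ 0 := by
      intro u u' hu hu' huv huv' hne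
      have e1 := orient_rotate (p v) (p a) (p b)
      have e2 := orient_rotate (p v) (p b) (p c)
      have e3 := orient_rotate (p v) (p c) (p a)
      have e4 := orient_swap (p a) (p b) (p v)
      have e5 := orient_swap (p b) (p c) (p v)
      have e6 := orient_swap (p c) (p a) (p v)
      have e7 := orient_rotate (p v) (p b) (p a)
      have e8 := orient_rotate (p v) (p c) (p b)
      have e9 := orient_rotate (p v) (p a) (p c)
      rcases (hadj u hu).1 huv with rfl | rfl | rfl <;>
        rcases (hadj u' hu').1 huv' with rfl | rfl | rfl <;>
        first
        | exact absurd rfl hne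
        | (apply ne_of_gt; linarith)
        | (apply ne_of_lt; linarith)
    have key2 : ∀ {u u' q}, u ∈ S → u' ∈ S → G.Adj v u → G.Adj v u' →
        q ∈ segment ℝ (p v) (p u) → q ∈ segment ℝ (p v) (p u') → u = u' ∨ q = p v := by
      intro u u' q hu hu' huv huv' hq hq'
      by_cases huu : u = u'
      · exact .inl huu
      · exact .inr (eq_of_orient_eq_zero (orient_eq_zero_of_mem_segment hq)
          (orient_eq_zero_of_mem_segment hq') (hne hu hu' huv huv' huu))
    have key3 : ∀ {u x y q}, u ∈ S → G.Adj v u → x ∈ insert v S → y ∈ insert v S → G.Adj x y →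
        q ∈ segment ℝ (p v) (p u) → q ∈ segment ℝ (p x) (p y) →
        s(v, u) = s(x, y) ∨ ∃ w, (w = v ∨ w = u) ∧ (w = x ∨ w = y) ∧ q = p w := by
      rintro u x y q hu huv (rfl | hx) (rfl | hy) hxy hq hq'
      · exact absurd rfl hxy.ne
      · rcases key2 hu hy huv hxy hq hq' with rfl | rfl
        · exact .inl rfl
        · exact .inr ⟨x, .inl rfl, .inl rfl, rfl⟩
      · rw [segment_symm] at hq'
        rcases key2 hu hx huv hxy.symm hq hq' with rfl | rfl
        · exact .inl Sym2.eq_swap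
        · exact .inr ⟨y, .inl rfl, .inr rfl, rfl⟩
      · obtain ⟨h1, h2⟩ := key hu huv hx hy hxy hq hq'
        exact .inr ⟨u, .inr rfl, h1, h2⟩
    rintro x y z w q (rfl | hx) (rfl | hy) hxy hz hw hzw hq hq'
    · exact absurd rfl hxy.ne
    · exact key3 hy hxy hz hw hzw hq hq'
    · rw [segment_symm] at hq
      rw [Sym2.eq_swap]
      rcases key3 hx hxy.symm hz hw hzw hq hq' with h1 | ⟨u, h1, h2⟩
      · exact .inl h1
      · exact .inr ⟨u, h1.symm, h2⟩
    · rcases hz with rfl | hz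
      · rcases hw with rfl | hw
        · exact absurd rfl hzw.ne
        rcases key3 hw hzw (.inr hx) (.inr hy) hxy hq' hq with h1 | ⟨u, h1, h2, h3⟩
        · exact .inl h1.symm
        · exact .inr ⟨u, h2, h1, h3⟩
      · rcases hw with rfl | hw
        · rw [segment_symm] at hq'
          rcases key3 hz hzw.symm (.inr hx) (.inr hy) hxy hq' hq with h1 | ⟨u, h1, h2, h3⟩
          · exact .inl (h1.symm.trans Sym2.eq_swap)
          · exact .inr ⟨u, h2, h1.symm, h3⟩
        · exact h.edge_edge hx hy hxy hz hw hzw hq hq'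

end PartialDrawing

/-! ### The induction that counts segments -/

/-- The edges of `G` between vertices of `S`. -/
def edgesIn {V : Type u} (G : SimpleGraph V) (S : Set V) : Set (Sym2 V) :=
  {e | ∃ x ∈ S, ∃ y ∈ S, G.Adj x y ∧ e = s(x, y)}

section Induction

variable {V : Type u} {G : SimpleGraph V} {A B C : V} {S : Set V}

theorem mk_mem_edgesIn {x y : V} : s(x, y) ∈ edgesIn G S ↔ x ∈ S ∧ y ∈ S ∧ G.Adj x y := by
  constructor
  · rintro ⟨a, ha, b, hb, hab, h⟩
    rcases Sym2.eq_iff.1 h with ⟨rfl, rfl⟩ | ⟨rfl, rfl⟩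
    exacts [⟨ha, hb, hab⟩, ⟨hb, ha, hab.symm⟩]
  · rintro ⟨hx, hy, hxy⟩
    exact ⟨x, hx, y, hy, hxy, rfl⟩

theorem edgesIn_univ : edgesIn G Set.univ = G.edgeSet := by
  ext e
  induction e with | _ x y
  rw [mk_mem_edgesIn]; simp

/-- The face `abc` can be entered by extending an edge beyond one of its corners. -/
def Extendable (G : SimpleGraph V) (S : Set V) (p : V → ℂ) (a b c : V) : Prop :=
  ∃ x y z d, IsRotation a b c x y z ∧ d ∈ S ∧ G.Adj d z ∧
    ∃ t : ℝ, 0 < t ∧ p z + t * (p z - p d) ∈ triInt (p a) (p b) (p c)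

/-- The faces given by `F` other than the outer face `ABC`. -/
def innerFaces (F : V → V → V → Prop) (A B C : V) (x y z : V) : Prop :=
  F x y z ∧ ¬ IsRotation A B C x y z

/-- The finite set `R` of edges meets every segment of the drawing `p` of `G` on `S`. -/
def MeetsSegments (G : SimpleGraph V) (S : Set V) (p : V → ℂ) (R : Finset (Sym2 V)) : Prop :=
  ∀ e ∈ edgesIn G S, ∃ r ∈ R, Relation.EqvGen (Aligned (edgesIn G S) p) e r

theorem IsRotation.symm {a b c x y z : V} (h : IsRotation a b c x y z) :
    IsRotation x y z a b c := by
  rcases h with ⟨rfl, rfl, rfl⟩ | ⟨rfl, rfl, rfl⟩ | ⟨rfl, rfl, rfl⟩ <;> simp [IsRotation]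

theorem FaceSystem.mem' {F : V → V → V → Prop} (hF : FaceSystem G S F) {x y z : V} (h : F x y z) :
    x ∈ S ∧ y ∈ S ∧ z ∈ S :=
  ⟨hF.mem h, hF.mem (hF.rotate h), hF.mem (hF.rotate (hF.rotate h))⟩

theorem isRotation_of_innerFaces {F : V → V → V → Prop} (hF : FaceSystem G {A, B, C} F) {x y z : V}
    (h : innerFaces F A B C x y z) : IsRotation A C B x y z := by
  obtain ⟨h1, h2⟩ := h
  obtain ⟨m1, m2, m3⟩ := hF.mem' h1
  have n1 := (hF.adj h1).ne
  have n2 := (hF.adj (hF.rotate h1)).ne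
  have n3 := (hF.adj (hF.rotate (hF.rotate h1))).ne
  unfold IsRotation at *
  rcases m1 with rfl | rfl | rfl <;> rcases m2 with rfl | rfl | rfl <;>
    rcases m3 with rfl | rfl | rfl <;> simp_all

/-- The induction step, with `h1` fixing the orientation of the link of `v`. One insertion adds one
vertex and at most two representatives, except that the first one adds three. -/
theorem exists_drawing_insert [Finite V] {F : V → V → V → Prop} {v a b c : V}
    (hF : FaceSystem G (insert v S) F) (hABC : F A B C) (hA : A ∈ S) (hB : B ∈ S) (hC : C ∈ S)
    (hv : v ∉ S) (ha : a ∈ S) (hb : b ∈ S) (hc : c ∈ S) (hab : G.Adj a b) (hbc : G.Adj b c)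
    (hca : G.Adj c a) (hadj : ∀ x ∈ S, G.Adj v x ↔ x = a ∨ x = b ∨ x = c) (h1 : F v a b)
    (ih : ∀ F, FaceSystem G S F → F A B C → ∃ p R, PartialDrawing G A B C S (innerFaces F A B C) p ∧
      MeetsSegments G S p R ∧ ((S = {A, B, C} ∧ R.card ≤ 3) ∨
        (R.card + 2 ≤ 2 * S.ncard ∧ ∀ x y z, innerFaces F A B C x y z → Extendable G S p x y z))) :
    ∃ p R, PartialDrawing G A B C (insert v S) (innerFaces F A B C) p ∧
      MeetsSegments G (insert v S) p R ∧ R.card + 2 ≤ 2 * (insert v S).ncard ∧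
        ∀ x y z, innerFaces F A B C x y z → Extendable G (insert v S) p x y z := by
  classical
  obtain ⟨h2, h3⟩ := hF.link_of_face hb hc hbc hca hadj h1
  have hF' := hF.remove hv ha hb hc hab hbc hca hadj h1 h2 h3
  have hne : ∀ {x}, x ∈ S → x ≠ v := fun hx h => hv (h ▸ hx)
  have hnotF : ¬ F a b c := fun h => hne hc (hF.unique h (hF.rotate h1))
  have hnotF' : ∀ {x y z}, F x y z → ¬ IsRotation a b c x y z := fun h hr =>
    hnotF (hF.of_isRotation h hr.symm)
  -- The outer face survives the deletion of `v` because its corners belong to `S`.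
  obtain ⟨p, R, hp, hR, hext⟩ := ih _ hF' (.inl ⟨hABC, hne hA, hne hB, hne hC⟩)
  set J := innerFaces (FaceSystem.removed F v a b c) A B C with hJdef
  have hJ : J a b c := ⟨.inr (by simp [IsRotation]), fun h => hnotF (hF.of_isRotation hABC h)⟩
  have hI : ∀ {x y z}, innerFaces F A B C x y z → (J x y z ∧ ¬ IsRotation a b c x y z) ∨
      IsRotation a b v x y z ∨ IsRotation b c v x y z ∨ IsRotation c a v x y z := by
    rintro x y z ⟨h, hr⟩
    rcases hF.face_cases hadj h1 h2 h3 h with h4 | h4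
    · exact .inl ⟨⟨.inl ⟨h, h4⟩, hr⟩, hnotF' h⟩
    · exact .inr h4
  have hcard : (insert v S).ncard = S.ncard + 1 := Set.ncard_insert_of_notMem hv (Set.toFinite _)
  -- Any point of the face gives a plane drawing. What depends on `q` is only which new edges
  -- continue an old segment, so both cases below reduce to choosing `q` and `R'`.
  have key : ∀ q ∈ triInt (p a) (p b) (p c), ∀ R' : Finset (Sym2 V), R ⊆ R' →
      (∀ u ∈ S, G.Adj v u → s(v, u) ∈ R' ∨ ∃ d ∈ S, G.Adj d u ∧
        ∃ t : ℝ, 0 < t ∧ q = p u + t * (p u - p d)) →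
      R'.card + 2 ≤ 2 * (insert v S).ncard →
      (∀ x y z, J x y z → ¬ IsRotation a b c x y z → Extendable G S p x y z) →
      ∃ p R, PartialDrawing G A B C (insert v S) (innerFaces F A B C) p ∧
        MeetsSegments G (insert v S) p R ∧ R.card + 2 ≤ 2 * (insert v S).ncard ∧
          ∀ x y z, innerFaces F A B C x y z → Extendable G (insert v S) p x y z := by
    intro q hq R' hRR' hcov hcard' hold
    have hp'v : Function.update p v q v = q := Function.update_self ..
    have hp' : ∀ x ∈ S, Function.update p v q x = p x := fun x hx =>
      Function.update_of_ne (hne hx) ..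
    set p' := Function.update p v q with hp'def
    have hdraw := (hp.congr hA hB hC (fun h => hF'.mem' h.1) hp').insert_vertex hv ha hb hc hab hbc
      hca hadj hJ (by rwa [hp'v, hp' a ha, hp' b hb, hp' c hc]) hI
    have hgen : ∀ {e f}, Relation.EqvGen (Aligned (edgesIn G S) p) e f →
        Relation.EqvGen (Aligned (edgesIn G (insert v S)) p') e f := by
      intro e f h
      refine h.mono ?_
      rintro _ _ ⟨he, hf, x, y, z, rfl, rfl, t, ht, hz⟩
      rw [mk_mem_edgesIn] at he hf
      refine ⟨mk_mem_edgesIn.2 ⟨.inr he.1, .inr he.2.1, he.2.2⟩,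
        mk_mem_edgesIn.2 ⟨.inr hf.1, .inr hf.2.1, hf.2.2⟩, x, y, z, rfl, rfl, t, ht, ?_⟩
      rwa [hp' x he.1, hp' y he.2.1, hp' z hf.2.1]
    have hedge : ∀ u ∈ S, G.Adj v u →
        ∃ r ∈ R', Relation.EqvGen (Aligned (edgesIn G (insert v S)) p') s(v, u) r := by
      intro u hu hvu
      rcases hcov u hu hvu with h | ⟨d, hd, hdu, t, ht, hqt⟩
      · exact ⟨_, h, .refl _⟩
      · obtain ⟨r, hr, hdr⟩ := hR s(d, u) (mk_mem_edgesIn.2 ⟨hd, hu, hdu⟩)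
        refine ⟨r, hRR' hr, .trans _ _ _ (.symm _ _ (.rel _ _ ?_)) (hgen hdr)⟩
        refine ⟨mk_mem_edgesIn.2 ⟨.inr hd, .inr hu, hdu⟩, mk_mem_edgesIn.2 ⟨.inl rfl, .inr hu, hvu⟩,
          d, u, v, rfl, Sym2.eq_swap, t, ht, ?_⟩
        rwa [hp'v, hp' u hu, hp' d hd]
    refine ⟨p', R', hdraw, ?_, hcard', ?_⟩
    · intro e he
      induction e with | _ x y
      rw [mk_mem_edgesIn] at he
      obtain ⟨rfl | hx, rfl | hy, hxy⟩ := he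
      · exact absurd rfl hxy.ne
      · exact hedge y hy hxy
      · rw [Sym2.eq_swap]
        exact hedge x hx hxy.symm
      · obtain ⟨r, hr, h⟩ := hR s(x, y) (mk_mem_edgesIn.2 ⟨hx, hy, hxy⟩)
        exact ⟨r, hRR' hr, hgen h⟩
    · have hnew : ∀ {d e f x y z}, IsRotation a b c d e f → IsRotation d e v x y z → f ∈ S →
          G.Adj v f → Extendable G (insert v S) p' x y z := by
        intro d e f x y z hr hr' hf hvf
        refine ⟨d, e, v, f, hr'.symm, .inr hf, hvf.symm, ?_⟩
        rw [triInt_of_isRotation hr']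
        refine exists_extension ?_
        rw [triInt_of_isRotation hr]
        rwa [hp'v, hp' a ha, hp' b hb, hp' c hc]
      intro x y z hf
      rcases hI hf with ⟨h4, h5⟩ | h4 | h4 | h4
      · obtain ⟨x', y', z', d, hr, hd, hdz, t, ht, hmem⟩ := hold x y z h4 h5
        obtain ⟨m1, m2, m3⟩ := hF'.mem' h4.1
        have hz' : z' ∈ S := by rcases hr with ⟨-, -, rfl⟩ | ⟨-, -, rfl⟩ | ⟨-, -, rfl⟩ <;> assumption
        refine ⟨x', y', z', d, hr, .inr hd, hdz, t, ht, ?_⟩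
        rwa [hp' x m1, hp' y m2, hp' z m3, hp' z' hz', hp' d hd]
      · exact hnew (f := c) (by simp [IsRotation]) h4 hc ((hadj c hc).2 (by simp))
      · exact hnew (f := a) (by simp [IsRotation]) h4 ha ((hadj a ha).2 (by simp))
      · exact hnew (f := b) (by simp [IsRotation]) h4 hb ((hadj b hb).2 (by simp))
  rcases hext with ⟨hS, hR3⟩ | ⟨hRc, hext⟩
  · obtain ⟨q, hq⟩ := triInt_nonempty (hp.inner_pos hJ)
    refine key q hq (R ∪ {s(v, a), s(v, b), s(v, c)}) Finset.subset_union_left ?_ ?_ ?_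
    · intro u hu hvu
      left
      rcases (hadj u hu).1 hvu with rfl | rfl | rfl <;> simp
    · have h4 := Finset.card_union_le R {s(v, a), s(v, b), s(v, c)}
      have h5 : ({s(v, a), s(v, b), s(v, c)} : Finset (Sym2 V)).card ≤ 3 := Finset.card_le_three
      have h6 : S.ncard = 3 := by
        have n1 := (hF.adj hABC).ne
        have n2 := (hF.adj (hF.rotate hABC)).ne
        have n3 := (hF.adj (hF.rotate (hF.rotate hABC))).ne
        rw [hS]
        exact Set.ncard_eq_three.2 ⟨A, B, C, n1, n3.symm, n2, rfl⟩
      omega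
    · subst hS
      intro x y z h4 h5
      exact absurd ((isRotation_of_innerFaces hF' hJ).symm_trans (isRotation_of_innerFaces hF' h4)) h5
  · obtain ⟨x, y, z, d, hr, hd, hdz, t, ht, hmem⟩ := hext a b c hJ
    refine key _ hmem (R ∪ {s(v, x), s(v, y)}) Finset.subset_union_left ?_ ?_
      fun x y z h _ => hext x y z h
    · intro u hu hvu
      have : u = x ∨ u = y ∨ u = z := by
        have := (hadj u hu).1 hvu
        rcases hr with ⟨rfl, rfl, rfl⟩ | ⟨rfl, rfl, rfl⟩ | ⟨rfl, rfl, rfl⟩ <;> tauto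
      rcases this with rfl | rfl | rfl
      · left; simp
      · left; simp
      · exact .inr ⟨d, hd, hdz, t, ht, rfl⟩
    · have h4 := Finset.card_union_le R {s(v, x), s(v, y)}
      have h5 : ({s(v, x), s(v, y)} : Finset (Sym2 V)).card ≤ 2 := Finset.card_le_two
      omega

/-- The bare triangle is a separate alternative because its inner face is not extendable. Its three
edges are one below `2 * 3 - 2`, and this slack pays for the extra representative of the first
insertion. -/
theorem exists_drawing [Finite V] (h : BuiltFrom G {A, B, C} S) (hAB : G.Adj A B)
    (hBC : G.Adj B C) (hCA : G.Adj C A) : ∀ F, FaceSystem G S F → F A B C →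
    ∃ p R, PartialDrawing G A B C S (innerFaces F A B C) p ∧
      MeetsSegments G S p R ∧ ((S = {A, B, C} ∧ R.card ≤ 3) ∨
        (R.card + 2 ≤ 2 * S.ncard ∧
          ∀ x y z, innerFaces F A B C x y z → Extendable G S p x y z)) := by
  classical
  induction h with
  | base =>
    intro F hF hABC
    -- The points `0`, `i`, `1` run clockwise, which puts the unbounded region on the left of `AB`.
    let p : V → ℂ := fun x => if x = A then 0 else if x = B then Complex.I else 1
    refine ⟨p, {s(A, B), s(B, C), s(C, A)}, ?_, ?_, .inl ⟨rfl, Finset.card_le_three⟩⟩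
    · refine PartialDrawing.triangle ?_ hAB.ne hBC.ne hCA.ne fun h => isRotation_of_innerFaces hF h
      simp [p, hAB.ne', hBC.ne', hCA.ne, orient, cross]
    · intro e he
      refine ⟨e, ?_, .refl _⟩
      induction e with | _ x y
      obtain ⟨hx, hy, hxy⟩ := mk_mem_edgesIn.1 he
      have := hxy.ne
      rcases hx with rfl | rfl | rfl <;> rcases hy with rfl | rfl | rfl <;>
        simp_all
  | @step S v a b c hS hv ha hb hc hab hbc hca hadj ih =>
    intro F hF hABC
    have hsub := hS.subset
    have hA : A ∈ S := hsub (by simp)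
    have hB : B ∈ S := hsub (by simp)
    have hC : C ∈ S := hsub (by simp)
    have hva : G.Adj v a := (hadj a ha).2 (.inl rfl)
    obtain ⟨y, hy⟩ := hF.exists_third (.inl rfl) (.inr ha) hva
    have hvy := (hF.adj (hF.rotate (hF.rotate hy))).symm
    have hyS : y ∈ S := (hF.mem' hy).2.2.resolve_left hvy.ne'
    have hay := (hF.adj (hF.rotate hy)).ne
    suffices h : ∃ p R, PartialDrawing G A B C (insert v S) (innerFaces F A B C) p ∧
      MeetsSegments G (insert v S) p R ∧ R.card + 2 ≤ 2 * (insert v S).ncard ∧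
        ∀ x y z, innerFaces F A B C x y z → Extendable G (insert v S) p x y z by
      obtain ⟨p, R, h1, h2, h3⟩ := h
      exact ⟨p, R, h1, h2, .inr h3⟩
    -- The construction does not know the orientation of the link of `v`; if the face on `va` ends
    -- in `c`, then `b` and `c` swap roles.
    rcases (hadj y hyS).1 hvy with rfl | rfl | rfl
    · exact absurd rfl hay
    · exact exists_drawing_insert hF hABC hA hB hC hv ha hb hc hab hbc hca hadj hy ih
    · exact exists_drawing_insert hF hABC hA hB hC hv ha hc hb hca.symm hbc.symm hab.symm
        (fun x hx => (hadj x hx).trans (by tauto)) hy ih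

end Induction

/-! ## Drawings of plane `3`-trees with few segments -/

/-- If `z` were strictly to the left, points just left of the midpoint of `d` would lie inside a
triangle of drawn edges, hence in a bounded component. -/
theorem orient_nonpos_of_unboundedOnLeft {V : Type u} {G : SimpleGraph V} {p : V → ℂ} {d : G.Dart}
    {z : V} (h1 : G.Adj d.snd z) (h2 : G.Adj z d.fst) (h : UnboundedOnLeft G p d) :
    orient (p d.fst) (p d.snd) (p z) ≤ 0 := by
  by_contra! hpos
  set a := p d.fst
  set b := p d.snd
  set c := p z
  have hne : 0 < (b - a).re ^ 2 + (b - a).im ^ 2 := by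
    by_contra! hc
    have e1 : (b - a).re = 0 := by nlinarith [sq_nonneg (b - a).re, sq_nonneg (b - a).im]
    have e2 : (b - a).im = 0 := by nlinarith [sq_nonneg (b - a).re, sq_nonneg (b - a).im]
    simp [orient, cross, e1, e2, -Complex.sub_re, -Complex.sub_im] at hpos
  have hcont : Continuous fun t : ℝ => (a + b) / 2 + t * (Complex.I * (b - a)) := by fun_prop
  have h0 : ∀ A B : ℂ, orient A B ((a + b) / 2 + (0 : ℝ) * (Complex.I * (b - a)))
      = (orient A B a + orient A B b) / 2 := by
    intro A B
    simp only [orient, cross, Complex.sub_re, Complex.sub_im, Complex.add_re, Complex.add_im,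
      Complex.ofReal_zero, zero_mul, add_zero, Complex.div_ofNat_re, Complex.div_ofNat_im]
    ring
  have hev : ∀ A B : ℂ, 0 < (orient A B a + orient A B b) / 2 → ∀ᶠ t : ℝ in 𝓝[>] 0,
      0 < orient A B ((a + b) / 2 + t * (Complex.I * (b - a))) := by
    intro A B hAB
    rw [← h0] at hAB
    exact (((continuous_orient A B).comp hcont).continuousAt.eventually (lt_mem_nhds hAB)).filter_mono
      nhdsWithin_le_nhds
  have e1 := hev b c (by rw [orient_self_left, orient_rotate]; linarith)
  have e2 := hev c a (by rw [orient_self_right, ← orient_rotate]; linarith)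
  have e3 : ∀ᶠ t : ℝ in 𝓝[>] 0, (0 : ℝ) < t := self_mem_nhdsWithin
  obtain ⟨t, ht1, ht2, ht3, hmem, hunb⟩ := (e1.and (e2.and (e3.and h))).exists
  refine hunb ((isBounded_triInt a b c).subset (connectedComponentIn_subset_triInt
    ⟨?_, ht1, ht2⟩ hmem ?_ ?_ ?_))
  · have : orient a b ((a + b) / 2 + t * (Complex.I * (b - a))) =
        t * ((b - a).re ^ 2 + (b - a).im ^ 2) := by
      simp only [orient, cross, Complex.sub_re, Complex.sub_im, Complex.add_re, Complex.add_im,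
        Complex.mul_re, Complex.mul_im, Complex.ofReal_re, Complex.ofReal_im, Complex.I_re,
        Complex.I_im, Complex.div_ofNat_re, Complex.div_ofNat_im]
      ring
    rw [this]; positivity
  all_goals
    refine Set.Subset.trans ?_ Set.subset_union_right
  · exact Set.subset_biUnion_of_mem (u := edgeSegment p) (show s(d.fst, d.snd) ∈ G.edgeSet from d.adj)
  · exact Set.subset_biUnion_of_mem (u := edgeSegment p) (show s(d.snd, z) ∈ G.edgeSet from h1)
  · exact Set.subset_biUnion_of_mem (u := edgeSegment p) (show s(z, d.fst) ∈ G.edgeSet from h2)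

/-- The whole drawing lies in the closed half-plane to the right of `d`, so the open left half-plane
is free. -/
theorem unboundedOnLeft_of_orient_nonpos {V : Type u} {G : SimpleGraph V} {p : V → ℂ} {d : G.Dart}
    (hd : p d.fst ≠ p d.snd) (h : ∀ x, orient (p d.fst) (p d.snd) (p x) ≤ 0) :
    UnboundedOnLeft G p d := by
  set a := p d.fst
  set b := p d.snd
  have hD : ∀ y ∈ drawnSet G p, orient a b y ≤ 0 := by
    rintro y (⟨x, rfl⟩ | hy)
    · exact h x
    · simp only [Set.mem_iUnion] at hy
      obtain ⟨e, -, hy⟩ := hy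
      induction e with | _ x w
      obtain ⟨s, t, hs, ht, hst, rfl⟩ := hy
      rw [orient_combo _ _ _ _ hst]
      nlinarith [mul_nonneg hs (neg_nonneg.2 (h x)), mul_nonneg ht (neg_nonneg.2 (h w))]
  have hne : 0 < (b - a).re ^ 2 + (b - a).im ^ 2 := by
    have : 0 < Complex.normSq (b - a) := Complex.normSq_pos.2 (sub_ne_zero.2 hd.symm)
    rw [Complex.normSq_apply] at this
    linarith
  filter_upwards [self_mem_nhdsWithin] with t ht
  have ht' : (0 : ℝ) < t := ht
  have hpos : 0 < orient a b ((a + b) / 2 + t * (Complex.I * (b - a))) := by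
    have : orient a b ((a + b) / 2 + t * (Complex.I * (b - a))) =
        t * ((b - a).re ^ 2 + (b - a).im ^ 2) := by
      simp only [orient, cross, Complex.sub_re, Complex.sub_im, Complex.add_re, Complex.add_im,
        Complex.mul_re, Complex.mul_im, Complex.ofReal_re, Complex.ofReal_im, Complex.I_re,
        Complex.I_im, Complex.div_ofNat_re, Complex.div_ofNat_im]
      ring
    rw [this]; positivity
  exact ⟨fun hmem => (hD _ hmem).not_gt hpos, not_isBounded_connectedComponentIn hd hD hpos⟩

theorem exists_mem_triInt_of_cross {a b c x : ℂ} (habc : 0 < orient a b c)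
    (h1 : 0 < cross (b - a) (x - a)) (h2 : 0 < cross (x - a) (c - a)) :
    ∃ y ∈ segment ℝ a x, y ∈ triInt a b c := by
  obtain ⟨s, hs0, hs1, hs⟩ : ∃ s : ℝ, 0 < s ∧ s < 1 ∧
      0 < (1 - s) * orient b c a + s * orient b c x := by
    rw [orient_rotate]
    rcases le_or_gt 0 (orient b c x) with h | h
    · exact ⟨1 / 2, by norm_num, by norm_num, by linarith⟩
    · have hD : 0 < 2 * (orient a b c - orient b c x) := by linarith
      -- Half of the parameter at which the segment `ax` reaches the line `bc`.
      refine ⟨orient a b c / (2 * (orient a b c - orient b c x)), by positivity, ?_, ?_⟩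
      · rw [div_lt_one hD]; linarith
      · have := div_mul_cancel₀ (orient a b c) hD.ne'
        linarith
  refine ⟨(1 - s) • a + s • x, ⟨1 - s, s, by linarith, hs0.le, by ring, rfl⟩, ?_, ?_, ?_⟩ <;>
    rw [orient_combo _ _ _ _ (by ring)]
  · rw [orient_self_left]
    have : 0 < orient a b x := h1
    nlinarith [mul_pos hs0 this]
  · exact hs
  · rw [orient_self_right]
    have : 0 < orient c a x := by
      rw [← orient_rotate]; exact h2
    nlinarith [mul_pos hs0 this]

theorem RotationSystem.IsFace.faceNext_eq {V : Type u} {G : SimpleGraph V} {R : RotationSystem G}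
    (hF : FaceSystem G Set.univ R.IsFace) {a b c : V} (h : R.IsFace a b c) (hab : G.Adj a b)
    (hbc : G.Adj b c) : R.faceNext ⟨(a, b), hab⟩ = ⟨(b, c), hbc⟩ := by
  obtain ⟨_, _, h'⟩ := hF.rotate h
  rw [faceNext_apply, Equiv.symm_apply_eq, h']; rfl

theorem RotationSystem.isRotation_iff {V : Type u} {G : SimpleGraph V} {R : RotationSystem G}
    (h3 : ∀ d, R.faceNext (R.faceNext (R.faceNext d)) = d) {a b c : V} (h : R.IsFace a b c)
    (hab : G.Adj a b) {d : G.Dart} {z : V} (hd : R.IsFace d.fst d.snd z) :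
    R.leftFace d = R.leftFace ⟨(a, b), hab⟩ ↔ IsRotation a b c d.fst d.snd z := by
  have hF := R.faceSystem h3
  have hbc := hF.adj (hF.rotate h)
  have hca := hF.adj (hF.rotate (hF.rotate h))
  have e1 := h.faceNext_eq hF hab hbc
  have e2 := (hF.rotate h).faceNext_eq hF hbc hca
  constructor
  · intro heq
    have hs : R.faceNext.SameCycle ⟨(a, b), hab⟩ d := (Quotient.exact heq).symm
    rcases sameCycle_mem_triple h3 hs with rfl | rfl | rfl
    · exact .inl ⟨rfl, rfl, hF.unique hd h⟩
    · rw [e1] at hd ⊢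
      exact .inr (.inl ⟨rfl, rfl, hF.unique hd (hF.rotate h)⟩)
    · rw [e1, e2] at hd ⊢
      exact .inr (.inr ⟨rfl, rfl, hF.unique hd (hF.rotate (hF.rotate h))⟩)
  · have : ∀ d', d' = ⟨(a, b), hab⟩ ∨ d' = R.faceNext ⟨(a, b), hab⟩ ∨
        d' = R.faceNext (R.faceNext ⟨(a, b), hab⟩) → R.leftFace d' = R.leftFace ⟨(a, b), hab⟩ :=
      fun d' hd' => triple_subset_cycle (σ := R.faceNext) _ hd'
    rintro (⟨f1, f2, -⟩ | ⟨f1, f2, -⟩ | ⟨f1, f2, -⟩)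
    · exact this d (.inl (by ext <;> assumption))
    · exact this d (.inr (.inl (by rw [e1]; ext <;> assumption)))
    · exact this d (.inr (.inr (by rw [e1, e2]; ext <;> assumption)))

theorem PartialDrawing.isPlaneDrawing {V : Type u} {G : SimpleGraph V} {A B C : V}
    {I : V → V → V → Prop} {p : V → ℂ} (h : PartialDrawing G A B C Set.univ I p) :
    IsPlaneDrawing G p where
  injective := fun x y hxy => h.injOn (Set.mem_univ x) (Set.mem_univ y) hxy
  mem_of_mem_edgeSegment := by
    intro e he v hv
    induction e with | _ x y
    exact Sym2.mem_iff.2 (h.vertex_edge (Set.mem_univ _) (Set.mem_univ _) he (Set.mem_univ _) hv)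
  not_crosses := by
    rintro e he f hf hef ⟨q, ⟨hq, hq'⟩, hno⟩
    induction e with | _ x y
    induction f with | _ z w
    rcases h.edge_edge (Set.mem_univ _) (Set.mem_univ _) he (Set.mem_univ _) (Set.mem_univ _) hf
      hq hq' with h1 | ⟨u, h1, h2, h3⟩
    · exact hef h1
    · exact hno ⟨u, Sym2.mem_iff.2 h1, Sym2.mem_iff.2 h2, h3⟩

/-- At a corner of an inner face, an edge strictly between the two sides would enter the empty
interior. At a corner of the outer face, all edges lie in the convex sector complementary to the
outer angle. For the outerface: every vertex lies weakly to the right of an outer dart, whereas the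
face of any other dart has its third vertex strictly to the left. -/
theorem PartialDrawing.isPlaneDrawingOf {V : Type u} [Fintype V] {G : SimpleGraph V}
    {P : PlaneEmbedding G} (h3 : ∀ d, P.faceNext (P.faceNext (P.faceNext d)) = d) {A B C : V}
    (hAB : G.Adj A B) (hABC : P.IsFace A B C) (hout : P.leftFace ⟨(A, B), hAB⟩ = P.outerFace)
    {p : V → ℂ} (h : PartialDrawing G A B C Set.univ (innerFaces P.IsFace A B C) p) :
    P.IsPlaneDrawingOf p := by
  have hF := P.faceSystem h3
  have hinj := h.isPlaneDrawing.injective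
  have houter : ∀ {x y z}, IsRotation A B C x y z → ∀ w, orient (p x) (p y) (p w) ≤ 0 := by
    intro x y z hr w
    obtain ⟨m1, m2, m3⟩ := h.mem_outer (Set.mem_univ w)
    rcases hr with ⟨rfl, rfl, rfl⟩ | ⟨rfl, rfl, rfl⟩ | ⟨rfl, rfl, rfl⟩ <;> assumption
  refine ⟨h.isPlaneDrawing, ?_, ?_⟩
  · rintro ⟨⟨a, b⟩, hab⟩ ⟨⟨a', x⟩, hax⟩ (rfl : a' = a)
    obtain ⟨c, hf⟩ := hF.exists_third (Set.mem_univ a') (Set.mem_univ b) hab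
    have hz : p b - p a' ≠ 0 := sub_ne_zero.2 (hinj.ne hab.ne')
    have hu : p x - p a' ≠ 0 := sub_ne_zero.2 (hinj.ne hax.ne')
    obtain ⟨_, hac, hrot⟩ := id hf
    have hw : p c - p a' ≠ 0 := sub_ne_zero.2 (hinj.ne hac.ne')
    rw [hrot]
    by_cases hr : IsRotation A B C a' b c
    · refine ccwAngle_le_of_cross_neg hz hw hu (houter hr x) ?_ ?_
      · have h1 := houter hr.rotate.rotate x
        have h2 : orient (p c) (p a') (p x) = -cross (p c - p a') (p x - p a') := by
          simp only [orient, cross, Complex.sub_re, Complex.sub_im]; ring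
        linarith
      · have := h.outer_neg
        rw [← orient_of_isRotation hr] at this
        exact this
    · have hpos := h.inner_pos ⟨hf, hr⟩
      refine ccwAngle_le_of_cross_pos hz hw hu hpos ?_
      rintro ⟨h1, h2⟩
      obtain ⟨y, hy, hy'⟩ := exists_mem_triInt_of_cross hpos h1 h2
      exact h.edge_disjoint ⟨hf, hr⟩ (Set.mem_univ _) (Set.mem_univ _) hax hy hy'
  · intro d
    obtain ⟨z, hf⟩ := hF.exists_third (Set.mem_univ d.fst) (Set.mem_univ d.snd) d.adj
    rw [← hout, RotationSystem.isRotation_iff h3 hABC hAB hf]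
    constructor
    · intro hr
      exact unboundedOnLeft_of_orient_nonpos (hinj.ne d.fst_ne_snd) (houter hr)
    · intro hu
      by_contra hr
      exact (orient_nonpos_of_unboundedOnLeft (hF.adj (hF.rotate hf))
        (hF.adj (hF.rotate (hF.rotate hf))) hu).not_gt (h.inner_pos ⟨hf, hr⟩)

theorem IsKTree.four_le_card {V : Type u} [Finite V] {G : SimpleGraph V} (h : IsKTree 3 G) :
    4 ≤ Nat.card V := by
  cases h with
  | complete hcard => omega
  | extend _ v _ hdeg _ =>
    have h1 := Set.ncard_insert_of_notMem (G.notMem_neighborSet_self (a := v)) (Set.toFinite _)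
    have h2 := Set.ncard_le_card (insert v (G.neighborSet v))
    omega

theorem PlaneEmbedding.exists_isPlaneDrawingOf {V : Type u} [Fintype V] {G : SimpleGraph V}
    (P : PlaneEmbedding G) (hG : IsKTree 3 G) :
    ∃ p : V → ℂ, P.IsPlaneDrawingOf p ∧ numSegments G p ≤ 2 * Fintype.card V - 2 := by
  have h3 := P.faceNext_faceNext_faceNext hG
  have hF := P.faceSystem h3
  obtain ⟨⟨⟨A, B⟩, hAB⟩, hd⟩ := Quotient.exists_rep P.outerFace
  obtain ⟨C, hABC⟩ := hF.exists_third (Set.mem_univ A) (Set.mem_univ B) hAB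
  have hBC := hF.adj (hF.rotate hABC)
  have hCA := hF.adj (hF.rotate (hF.rotate hABC))
  obtain ⟨p, R, hp, hR, hcard⟩ := exists_drawing (hG.builtFrom hAB hBC hCA) hAB hBC hCA _ hF hABC
  refine ⟨p, hp.isPlaneDrawingOf h3 hAB hABC hd, ?_⟩
  rw [MeetsSegments, edgesIn_univ] at hR
  refine (numSegments_le_card hp.isPlaneDrawing.injective R hR).trans ?_
  have hV : (Set.univ : Set V).ncard = Fintype.card V := by
    rw [Set.ncard_univ, Nat.card_eq_fintype_card]
  -- The bare triangle is excluded, since a `3`-tree has at least four vertices.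
  rcases hcard with ⟨hS, -⟩ | ⟨hRc, -⟩
  · have h4 := hG.four_le_card
    have h5 : ({A, B, C} : Set V).ncard = 3 :=
      Set.ncard_eq_three.2 ⟨A, B, C, hAB.ne, hCA.ne', hBC.ne, rfl⟩
    rw [← hS, Set.ncard_univ] at h5
    omega
  · omega

/-! ## A plane `3`-tree of nested triangles -/

/-- The graph on `ℕ` in which `0` and `1` are adjacent to all other vertices and the remaining
vertices form a path. -/
def nestedGraph : SimpleGraph ℕ where
  Adj x y := x ≠ y ∧ (x = 0 ∨ y = 0 ∨ x = 1 ∨ y = 1 ∨ x + 1 = y ∨ y + 1 = x)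
  symm := ⟨fun x y h => by omega⟩
  loopless := ⟨fun x h => h.1 rfl⟩

theorem nestedGraph_adj {x y : ℕ} : nestedGraph.Adj x y ↔
    x ≠ y ∧ (x = 0 ∨ y = 0 ∨ x = 1 ∨ y = 1 ∨ x + 1 = y ∨ y + 1 = x) := Iff.rfl

/-- Stated for an arbitrary labelling `f`, because deleting the vertex with the largest label leaves
a subtype rather than some `Fin m`. -/
theorem isKTree_comap_nestedGraph {m : ℕ} (hm : 4 ≤ m) : ∀ {V : Type u} (f : V → ℕ),
    Function.Injective f → Set.range f = {x | x < m} → IsKTree 3 (nestedGraph.comap f) := by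
  induction m, hm using Nat.le_induction with
  | base =>
    intro V f hf hr
    have : nestedGraph.comap f = ⊤ := by
      ext x y
      have hx : f x < 4 := hr.le ⟨x, rfl⟩
      have hy : f y < 4 := hr.le ⟨y, rfl⟩
      rw [SimpleGraph.comap_adj, nestedGraph_adj, SimpleGraph.top_adj, hf.ne_iff]
      refine ⟨fun h => h.1, fun h => ⟨h, ?_⟩⟩
      have := hf.ne h
      omega
    rw [this]
    refine .complete ?_
    rw [← Set.ncard_univ, ← Set.ncard_image_of_injective _ hf, Set.image_univ, hr]
    exact Set.ncard_Iio_nat 4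
  | succ m hm ih =>
    intro V f hf hr
    obtain ⟨v, hv⟩ : m ∈ Set.range f := hr.ge (Nat.lt_succ_self m)
    have hmem : ∀ x, f x < m + 1 := fun x => hr.le ⟨x, rfl⟩
    have hN : f '' (nestedGraph.comap f).neighborSet v = {0, 1, m - 1} := by
      ext k
      simp only [Set.mem_image, SimpleGraph.mem_neighborSet, SimpleGraph.comap_adj, hv,
        nestedGraph_adj, Set.mem_insert_iff, Set.mem_singleton_iff]
      constructor
      · rintro ⟨x, hx, rfl⟩
        have := hmem x
        omega
      · intro hk
        obtain ⟨x, rfl⟩ : k ∈ Set.range f := hr.ge (show k < m + 1 by omega)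
        exact ⟨x, by omega, rfl⟩
    refine .extend _ v ?_ ?_ ?_
    · intro x hx y hy hxy
      have h1 : f x ∈ ({0, 1, m - 1} : Set ℕ) := hN ▸ Set.mem_image_of_mem f hx
      have h2 : f y ∈ ({0, 1, m - 1} : Set ℕ) := hN ▸ Set.mem_image_of_mem f hy
      simp only [Set.mem_insert_iff, Set.mem_singleton_iff] at h1 h2
      have := hf.ne hxy
      rw [SimpleGraph.comap_adj, nestedGraph_adj]
      omega
    · rw [← Set.ncard_image_of_injective _ hf, hN]
      exact Set.ncard_eq_three.2 ⟨0, 1, m - 1, by omega, by omega, by omega, rfl⟩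
    · refine ih (f ∘ Subtype.val) (hf.comp Subtype.val_injective) ?_
      ext k
      constructor
      · rintro ⟨⟨x, hx⟩, rfl⟩
        have h1 := hmem x
        have h2 : f x ≠ m := fun h => hx (hf (h.trans hv.symm))
        change f x < m
        omega
      · intro hk
        have hk' : k < m := hk
        obtain ⟨x, rfl⟩ : k ∈ Set.range f := hr.ge (show k < m + 1 by omega)
        exact ⟨⟨x, by rintro rfl; omega⟩, rfl⟩

/-- The neighbour of `x` that follows `y` anticlockwise in the nested drawing with `n` vertices. -/
def nestedNext (n x y : ℕ) : ℕ :=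
  if x = 0 then if y + 1 < n then y + 1 else 1
  else if x = 1 then if y = 0 then n - 1 else if y = 2 then 0 else y - 1
  else if y = 0 then if x = 2 then 1 else x - 1
  else if y = 1 then if x + 1 < n then x + 1 else 0
  else if y = x + 1 then 0 else 1

/-- The neighbour of `x` that precedes `y` anticlockwise in the nested drawing with `n`
vertices. -/
def nestedPrev (n x y : ℕ) : ℕ :=
  if x = 0 then if y = 1 then n - 1 else y - 1
  else if x = 1 then if y = n - 1 then 0 else if y = 0 then 2 else y + 1
  else if y = 0 then if x + 1 < n then x + 1 else 1
  else if y = 1 then if x = 2 then 0 else x - 1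
  else if y = x + 1 then 1 else 0

/-! ### The embedding of the nested triangles -/

section Nested

variable {n x y : ℕ}

theorem nestedNext_spec (hn : 4 ≤ n) (hx : x < n) (hy : y < n) (h : nestedGraph.Adj x y) :
    nestedNext n x y < n ∧ nestedGraph.Adj x (nestedNext n x y) ∧
      nestedPrev n x (nestedNext n x y) = y := by
  rw [nestedGraph_adj] at h ⊢
  generalize hz : nestedNext n x y = z
  unfold nestedNext at hz
  unfold nestedPrev
  split_ifs at hz ⊢ <;> omega

theorem nestedPrev_spec (hn : 4 ≤ n) (hx : x < n) (hy : y < n) (h : nestedGraph.Adj x y) :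
    nestedPrev n x y < n ∧ nestedGraph.Adj x (nestedPrev n x y) ∧
      nestedNext n x (nestedPrev n x y) = y := by
  rw [nestedGraph_adj] at h ⊢
  generalize hz : nestedPrev n x y = z
  unfold nestedPrev at hz
  unfold nestedNext
  split_ifs at hz ⊢ <;> omega

/-- Closing up of the facial triangles: `faceNext` takes `(x, y)` to `(y, z)` with `z = nestedPrev n
y x`, and then to `(z, x)`. -/
theorem nestedPrev_nestedPrev (hn : 4 ≤ n) (hx : x < n) (hy : y < n) (h : nestedGraph.Adj x y) :
    nestedPrev n (nestedPrev n y x) y = x := by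
  rw [nestedGraph_adj] at h
  generalize hz : nestedPrev n y x = z
  unfold nestedPrev at hz
  unfold nestedPrev
  split_ifs at hz ⊢ <;> omega

/-- The dart from `x` to `y`. -/
def nestedDart (n : ℕ) {x y : ℕ} (hx : x < n) (hy : y < n) (h : nestedGraph.Adj x y) :
    (nestedGraph.comap (Fin.val : Fin n → ℕ)).Dart :=
  ⟨(⟨x, hx⟩, ⟨y, hy⟩), h⟩

theorem nestedDart_congr {x' y' : ℕ} {hx : x < n} {hy : y < n} {h : nestedGraph.Adj x y}
    {hx' : x' < n} {hy' : y' < n} {h' : nestedGraph.Adj x' y'} (h1 : x = x') (h2 : y = y') :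
    nestedDart n hx hy h = nestedDart n hx' hy' h' := by
  subst h1 h2; rfl

/-- The anticlockwise rotation of the nested drawing. -/
def nestedRot (hn : 4 ≤ n) : Equiv.Perm (nestedGraph.comap (Fin.val : Fin n → ℕ)).Dart where
  toFun d := nestedDart n d.fst.2 (nestedNext_spec hn d.fst.2 d.snd.2 d.adj).1
    (nestedNext_spec hn d.fst.2 d.snd.2 d.adj).2.1
  invFun d := nestedDart n d.fst.2 (nestedPrev_spec hn d.fst.2 d.snd.2 d.adj).1
    (nestedPrev_spec hn d.fst.2 d.snd.2 d.adj).2.1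
  left_inv d := nestedDart_congr rfl (nestedNext_spec hn d.fst.2 d.snd.2 d.adj).2.2
  right_inv d := nestedDart_congr rfl (nestedPrev_spec hn d.fst.2 d.snd.2 d.adj).2.2

theorem nestedRot_apply (hn : 4 ≤ n) (hx : x < n) (hy : y < n) (h : nestedGraph.Adj x y) {z : ℕ}
    (hz : z < n) (h' : nestedGraph.Adj x z) (hxyz : nestedNext n x y = z) :
    nestedRot hn (nestedDart n hx hy h) = nestedDart n hx hz h' :=
  nestedDart_congr rfl hxyz

theorem sameCycle_nestedRot (hn : 4 ≤ n) (hx : x < n) (hy : y < n) (h : nestedGraph.Adj x y)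
    {z : ℕ} (hz : z < n) (h' : nestedGraph.Adj x z) (hxyz : nestedNext n x y = z) :
    (nestedRot hn).SameCycle (nestedDart n hx hy h) (nestedDart n hx hz h') :=
  ⟨1, by rw [zpow_one, nestedRot_apply hn hx hy h hz h' hxyz]⟩

theorem sameCycle_nestedRot_zero (hn : 4 ≤ n) (hy : y < n) (h : nestedGraph.Adj 0 y) :
    (nestedRot hn).SameCycle (nestedDart n (by omega) hy h)
      (nestedDart n (x := 0) (y := 1) (by omega) (by omega) (by simp [nestedGraph_adj])) := by
  induction y with
  | zero => exact absurd rfl h.ne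
  | succ y ih =>
    rcases Nat.eq_zero_or_pos y with rfl | hy0
    · exact .refl _ _
    · have h' : nestedGraph.Adj 0 y := by rw [nestedGraph_adj]; omega
      refine (sameCycle_nestedRot hn (by omega) (by omega) h' hy h ?_).symm.trans (ih (by omega) h')
      simp [nestedNext, hy]

theorem sameCycle_nestedRot_one (hn : 4 ≤ n) (hy : y < n) (h : nestedGraph.Adj 1 y) :
    (nestedRot hn).SameCycle (nestedDart n (by omega) hy h)
      (nestedDart n (x := 1) (y := 0) (by omega) (by omega) (by simp [nestedGraph_adj])) := by
  induction y with
  | zero => exact .refl _ _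
  | succ y ih =>
    have hy0 : y ≠ 0 := by rintro rfl; exact h.ne rfl
    by_cases hy1 : y = 1
    · subst hy1
      exact sameCycle_nestedRot hn (by omega) hy h (by omega) (by simp [nestedGraph_adj]) (by simp [nestedNext])
    · have h' : nestedGraph.Adj 1 y := by rw [nestedGraph_adj]; omega
      refine (sameCycle_nestedRot hn (by omega) hy h (by omega) h' ?_).trans (ih (by omega) h')
      simp [nestedNext, hy1]

theorem nestedNext_add_one (hx : 2 ≤ x) : nestedNext n x (x + 1) = 0 := by
  rw [nestedNext, if_neg (by omega), if_neg (by omega), if_neg (by omega), if_neg (by omega),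
    if_pos rfl]

theorem nestedNext_one (hx : 2 ≤ x) : nestedNext n x 1 = if x + 1 < n then x + 1 else 0 := by
  rw [nestedNext, if_neg (by omega), if_neg (by omega), if_neg one_ne_zero, if_pos rfl]

/-- The anticlockwise order at an inner vertex is `0`, `x-1`, `1`, `x+1`, with the entries that
coincide or do not exist left out; each neighbour is followed back to `0`. -/
theorem sameCycle_nestedRot_two_le (hn : 4 ≤ n) (hx2 : 2 ≤ x) (hx : x < n) (hy : y < n)
    (h : nestedGraph.Adj x y) :
    (nestedRot hn).SameCycle (nestedDart n hx hy h)
      (nestedDart n (y := 0) hx (by omega) (by rw [nestedGraph_adj]; omega)) := by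
  have h0 : nestedGraph.Adj x 0 := by rw [nestedGraph_adj]; omega
  have h1 : nestedGraph.Adj x 1 := by rw [nestedGraph_adj]; omega
  have hs : ∀ hx1 : x + 1 < n, ∀ h' : nestedGraph.Adj x (x + 1), (nestedRot hn).SameCycle
      (nestedDart n hx hx1 h') (nestedDart n hx (by omega) h0) := fun hx1 h' =>
    sameCycle_nestedRot hn hx hx1 h' (by omega) h0 (nestedNext_add_one hx2)
  have hone : (nestedRot hn).SameCycle (nestedDart n hx (by omega) h1)
      (nestedDart n hx (by omega) h0) := by
    by_cases hx1 : x + 1 < n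
    · have h' : nestedGraph.Adj x (x + 1) := by rw [nestedGraph_adj]; omega
      exact (sameCycle_nestedRot hn hx (by omega) h1 hx1 h' (by rw [nestedNext_one hx2, if_pos hx1])).trans
        (hs hx1 h')
    · exact sameCycle_nestedRot hn hx (by omega) h1 (by omega) h0
        (by rw [nestedNext_one hx2, if_neg hx1])
  by_cases hy0 : y = 0
  · subst hy0; exact .refl _ _
  by_cases hy1 : y = 1
  · subst hy1; exact hone
  by_cases hyx : y = x + 1
  · subst hyx; exact hs _ _
  refine (sameCycle_nestedRot hn hx hy h (by omega) h1 ?_).trans hone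
  rw [nestedGraph_adj] at h
  unfold nestedNext; split_ifs <;> omega

/-- The rotation system of the nested drawing. -/
def nestedRotationSystem (hn : 4 ≤ n) :
    RotationSystem (nestedGraph.comap (Fin.val : Fin n → ℕ)) where
  rot := nestedRot hn
  fst_rot _ := rfl
  sameCycle_rot := by
    rintro ⟨⟨⟨x, hx⟩, ⟨y, hy⟩⟩, h⟩ ⟨⟨⟨x', hx'⟩, ⟨z, hz⟩⟩, h'⟩ hxx
    obtain rfl : x = x' := congrArg Fin.val hxx
    by_cases hx0 : x = 0
    · subst hx0
      exact (sameCycle_nestedRot_zero hn hy h).trans (sameCycle_nestedRot_zero hn hz h').symm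
    by_cases hx1 : x = 1
    · subst hx1
      exact (sameCycle_nestedRot_one hn hy h).trans (sameCycle_nestedRot_one hn hz h').symm
    have hx2 : 2 ≤ x := by omega
    exact (sameCycle_nestedRot_two_le hn hx2 hx hy h).trans
      (sameCycle_nestedRot_two_le hn hx2 hx hz h').symm

theorem nestedRotationSystem_faceNext (hn : 4 ≤ n)
    (d : (nestedGraph.comap (Fin.val : Fin n → ℕ)).Dart) :
    (nestedRotationSystem hn).faceNext ((nestedRotationSystem hn).faceNext
      ((nestedRotationSystem hn).faceNext d)) = d := by
  obtain ⟨⟨⟨x, hx⟩, ⟨y, hy⟩⟩, h⟩ := d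
  have h : nestedGraph.Adj x y := h
  obtain ⟨hz, hyz, -⟩ := nestedPrev_spec hn hy hx h.symm
  have e1 := nestedPrev_nestedPrev hn hx hy h
  have e2 := nestedPrev_nestedPrev hn hy hz hyz
  rw [e1] at e2
  refine nestedDart_congr e1 ?_
  change nestedPrev n (nestedPrev n (nestedPrev n y x) y) (nestedPrev n y x) = y
  rw [e1, e2]

theorem isKTree_nestedGraph (hn : 4 ≤ n) :
    IsKTree 3 (nestedGraph.comap (Fin.val : Fin n → ℕ)) :=
  isKTree_comap_nestedGraph hn _ Fin.val_injective (by ext k; simp)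

/-- The plane `3`-tree of nested triangles `0`, `1`, `k`. -/
def nestedEmbedding (hn : 4 ≤ n) :
    PlaneEmbedding (nestedGraph.comap (Fin.val : Fin n → ℕ)) where
  toRotationSystem := nestedRotationSystem hn
  connected := by
    have : Nonempty (Fin n) := ⟨⟨0, by omega⟩⟩
    refine (SimpleGraph.connected_iff_exists_forall_reachable _).2 ⟨⟨0, by omega⟩, ?_⟩
    rintro ⟨x, hx⟩
    by_cases hx0 : x = 0
    · subst hx0; exact .refl _
    · refine SimpleGraph.Adj.reachable (show nestedGraph.Adj 0 x from ?_)
      rw [nestedGraph_adj]; omega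
  euler := by
    have h1 := (isKTree_nestedGraph hn).card_edgeSet
    have h2 := card_dart (nestedGraph.comap (Fin.val : Fin n → ℕ))
    have h3 : 3 * Nat.card (nestedRotationSystem hn).Face = _ :=
      three_mul_card_sameCycle (nestedRotationSystem hn).faceNext_ne
        (nestedRotationSystem_faceNext hn)
    rw [Nat.card_eq_fintype_card (α := Fin n)] at h1
    omega
  outerFace := (nestedRotationSystem hn).leftFace
    (nestedDart n (x := 1) (y := 0) (by omega) (by omega) (by simp [nestedGraph_adj]))

end Nested

/-! ## Slopes of drawings of the nested triangles -/

/-- Of three collinear points one lies between the other two, hence on an edge of which it is not an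
endpoint. -/
theorem IsDrawing.orient_ne_zero {V : Type u} {G : SimpleGraph V} {p : V → ℂ} (hp : IsDrawing G p)
    {x y z : V} (hxy : G.Adj x y) (hyz : G.Adj y z) (hzx : G.Adj z x) :
    orient (p x) (p y) (p z) ≠ 0 := by
  intro h
  have hne := hp.injective.ne hxy.ne
  have hN : (p y - p x).re ^ 2 + (p y - p x).im ^ 2 ≠ 0 := by
    have : 0 < Complex.normSq (p y - p x) := Complex.normSq_pos.2 (sub_ne_zero.2 hne.symm)
    rw [Complex.normSq_apply] at this
    nlinarith
  obtain ⟨r, hr⟩ : ∃ r : ℝ, p z = r • (p y - p x) + p x := by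
    -- The coefficient of the orthogonal projection of `p z - p x` to `p y - p x`.
    refine ⟨((p y - p x).re * (p z - p x).re + (p y - p x).im * (p z - p x).im) /
      ((p y - p x).re ^ 2 + (p y - p x).im ^ 2), ?_⟩
    rw [← sub_eq_iff_eq_add]
    rw [orient, cross] at h
    generalize p y - p x = w at *
    generalize p z - p x = v at *
    apply Complex.ext
    · rw [Complex.real_smul, Complex.re_ofReal_mul, div_mul_eq_mul_div, eq_div_iff hN]
      linear_combination (-w.im) * h
    · rw [Complex.real_smul, Complex.im_ofReal_mul, div_mul_eq_mul_div, eq_div_iff hN]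
      linear_combination w.re * h
  have hcol : Collinear ℝ {p x, p y, p z} := by
    rw [collinear_iff_of_mem (p₀ := p x) (by simp)]
    refine ⟨p y - p x, ?_⟩
    rintro q (rfl | rfl | rfl)
    · exact ⟨0, by simp⟩
    · exact ⟨1, by simp⟩
    · exact ⟨r, by simpa using hr⟩
  have hmem : ∀ {u v w : V}, G.Adj u v → w ≠ u → w ≠ v → ¬ Wbtw ℝ (p u) (p w) (p v) := by
    intro u v w huv h1 h2 hw
    rcases Sym2.mem_iff.1 (hp.mem_of_mem_edgeSegment s(u, v) huv w (mem_segment_iff_wbtw.2 hw)) with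
      h | h
    exacts [h1 h, h2 h]
  rcases hcol.wbtw_or_wbtw_or_wbtw with h1 | h1 | h1
  · exact hmem hzx.symm hxy.ne' hyz.ne h1
  · exact hmem hxy.symm hyz.ne' hzx.ne h1
  · exact hmem hyz.symm hzx.ne' hxy.ne h1

/-- The cotangent of the angle from `u` to `w`. -/
def cotan (u w : ℂ) : ℝ := (u.re * w.re + u.im * w.im) / cross u w

theorem cross_mul_eq (u v w : ℂ) : (u.re ^ 2 + u.im ^ 2) * cross v w =
    (u.re * v.re + u.im * v.im) * cross u w - (u.re * w.re + u.im * w.im) * cross u v := by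
  simp only [cross]; ring

/-- On the directions to the left of `u` the cotangent is strictly decreasing in the angle, so it
orders them by a real number without any reduction of angles. -/
theorem cotan_lt_cotan {u v w : ℂ} (hv : 0 < cross u v) (hw : 0 < cross u w) (h : 0 < cross v w) :
    cotan u w < cotan u v := by
  have hu : 0 < u.re ^ 2 + u.im ^ 2 := by
    have : 0 < Complex.normSq u := Complex.normSq_pos.2 (by rintro rfl; simp [cross] at hv)
    rw [Complex.normSq_apply] at this
    nlinarith
  rw [cotan, cotan, div_lt_div_iff₀ hw hv]
  nlinarith [cross_mul_eq u v w, mul_pos hu h]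

theorem cotan_eq_cotan {u v w : ℂ} (hv : 0 < cross u v) (hw : 0 < cross u w) (h : cross v w = 0) :
    cotan u v = cotan u w := by
  rw [cotan, cotan, div_eq_div_iff hv.ne' hw.ne']
  have := cross_mul_eq u v w
  rw [h, mul_zero] at this
  linarith

theorem Fin.strictMono_of_lt_add_one {α : Type*} [Preorder α] {m : ℕ} {f : Fin m → α}
    (h : ∀ (i : ℕ) (hi : i + 1 < m), f ⟨i, by omega⟩ < f ⟨i + 1, hi⟩) : StrictMono f := by
  cases m with
  | zero => exact fun i => i.elim0
  | succ m => exact Fin.strictMono_iff_lt_succ.2 fun i => h i (by omega)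

/-! ### The fans of edges at the vertices `0` and `1` -/

section Nested

variable {n : ℕ} {hn : 4 ≤ n} {p : Fin n → ℂ}

theorem nestedEmbedding_rot (hn : 4 ≤ n) {x y z : ℕ} (hx : x < n) (hy : y < n) (hz : z < n)
    (h : nestedGraph.Adj x y) (hxyz : nestedNext n x y = z) :
    ((nestedEmbedding hn).rot (nestedDart n hx hy h)).snd = ⟨z, hz⟩ := Fin.ext hxyz

theorem rot_next_nested (hp : (nestedEmbedding hn).IsPlaneDrawingOf p) {x y z w : ℕ} (hx : x < n)
    (hy : y < n) (hz : z < n) (hw : w < n) (hxy : nestedGraph.Adj x y) (hxw : nestedGraph.Adj x w)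
    (h : nestedNext n x y = z) :
    ccwAngle (p ⟨y, hy⟩ - p ⟨x, hx⟩) (p ⟨z, hz⟩ - p ⟨x, hx⟩) ≤
      ccwAngle (p ⟨y, hy⟩ - p ⟨x, hx⟩) (p ⟨w, hw⟩ - p ⟨x, hx⟩) := by
  have := hp.rot_next (nestedDart n hx hy hxy) (nestedDart n hx hw hxw) rfl
  rw [nestedEmbedding_rot hn hx hy hz hxy h] at this
  exact this

theorem orient_ne_zero_nested (hp : (nestedEmbedding hn).IsPlaneDrawingOf p) {k : ℕ} (hk2 : 2 ≤ k)
    (hk : k < n) : orient (p ⟨0, by omega⟩) (p ⟨1, by omega⟩) (p ⟨k, hk⟩) ≠ 0 :=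
  hp.orient_ne_zero (show nestedGraph.Adj 0 1 by simp [nestedGraph_adj])
    (show nestedGraph.Adj 1 k by rw [nestedGraph_adj]; omega)
    (show nestedGraph.Adj k 0 by rw [nestedGraph_adj]; omega)

theorem orient_pos_last (hp : (nestedEmbedding hn).IsPlaneDrawingOf p) :
    0 < orient (p ⟨0, by omega⟩) (p ⟨1, by omega⟩) (p ⟨n - 1, by omega⟩) := by
  refine lt_of_le_of_ne ?_ (orient_ne_zero_nested hp (by omega) (by omega)).symm
  have h10 : nestedGraph.Adj 1 0 := by simp [nestedGraph_adj]
  have := orient_nonpos_of_unboundedOnLeft (G := nestedGraph.comap (Fin.val : Fin n → ℕ))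
    (d := nestedDart n (by omega) (by omega) h10) (z := ⟨n - 1, by omega⟩)
    (show nestedGraph.Adj 0 (n - 1) by rw [nestedGraph_adj]; omega)
    (show nestedGraph.Adj (n - 1) 1 by rw [nestedGraph_adj]; omega)
    ((hp.outer_iff _).1 rfl)
  have h2 : orient (p ⟨1, by omega⟩) (p ⟨0, by omega⟩) (p ⟨n - 1, by omega⟩) ≤ 0 := this
  rw [orient_swap] at h2
  linarith

/-- At `0` the edge to `k` is followed by the edge to `k + 1`, so it lies between the edges to `1`
and to `k + 1`. The side of `k + 1` is thus inherited by `k`. -/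
theorem cross_pos_left_step (hp : (nestedEmbedding hn).IsPlaneDrawingOf p) {k : ℕ} (hk2 : 2 ≤ k)
    (hk : k + 1 < n)
    (h : 0 < orient (p ⟨0, by omega⟩) (p ⟨1, by omega⟩) (p ⟨k + 1, hk⟩)) :
    0 < orient (p ⟨0, by omega⟩) (p ⟨1, by omega⟩) (p ⟨k, by omega⟩) ∧
      0 < orient (p ⟨0, by omega⟩) (p ⟨k, by omega⟩) (p ⟨k + 1, hk⟩) := by
  have hne : ∀ {j : ℕ} (hj : j < n), j ≠ 0 → p ⟨j, hj⟩ - p ⟨0, by omega⟩ ≠ 0 := fun hj h0 =>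
    sub_ne_zero.2 (hp.injective.ne fun h => h0 (congrArg Fin.val h))
  refine cross_pos_of_ccwAngle_le (hne _ one_ne_zero) (hne _ (by omega)) (hne _ (by omega)) h
    (orient_ne_zero_nested hp hk2 (by omega)) ?_
  exact rot_next_nested hp (by omega) (by omega) hk (by omega)
    (by rw [nestedGraph_adj]; omega) (by rw [nestedGraph_adj]; omega) (by simp [nestedNext, hk])

theorem orient_pos_nested (hp : (nestedEmbedding hn).IsPlaneDrawingOf p) {k : ℕ} (hk2 : 2 ≤ k)
    (hk : k < n) : 0 < orient (p ⟨0, by omega⟩) (p ⟨1, by omega⟩) (p ⟨k, hk⟩) := by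
  -- Induction inwards from the outer vertex `n - 1`, whose side is known from the outerface.
  obtain ⟨j, hj⟩ : ∃ j, k + j = n - 1 := ⟨n - 1 - k, by omega⟩
  induction j generalizing k with
  | zero =>
    obtain rfl : k = n - 1 := by omega
    exact orient_pos_last hp
  | succ j ih => exact (cross_pos_left_step hp hk2 (by omega) (ih (by omega) (by omega) (by omega))).1

theorem cross_pos_right_step (hp : (nestedEmbedding hn).IsPlaneDrawingOf p) {k : ℕ} (hk2 : 2 ≤ k)
    (hk : k + 1 < n) :
    0 < orient (p ⟨1, by omega⟩) (p ⟨k + 1, hk⟩) (p ⟨k, by omega⟩) := by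
  have hne : ∀ {j : ℕ} (hj : j < n), j ≠ 1 → p ⟨j, hj⟩ - p ⟨1, by omega⟩ ≠ 0 := fun hj h0 =>
    sub_ne_zero.2 (hp.injective.ne fun h => h0 (congrArg Fin.val h))
  have h1 := orient_pos_nested hp (show 2 ≤ k + 1 by omega) hk
  have h2 := orient_pos_nested hp hk2 (by omega)
  rw [← orient_rotate] at h1 h2
  refine (cross_pos_of_ccwAngle_le' (hne (j := 0) (by omega) zero_ne_one) (hne _ (by omega))
    (hne _ (by omega)) h1 h2.ne' ?_).2
  exact rot_next_nested hp (by omega) hk (by omega) (by omega)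
    (by rw [nestedGraph_adj]; omega) (by rw [nestedGraph_adj]; omega)
    (by rw [nestedNext, if_neg one_ne_zero, if_pos rfl, if_neg (by omega), if_neg (by omega),
      Nat.add_sub_cancel])

theorem card_le_numSlopes_nested (hp : (nestedEmbedding hn).IsPlaneDrawingOf p) :
    2 * n - 2 ≤ numSlopes (nestedGraph.comap (Fin.val : Fin n → ℕ)) p := by
  set G := nestedGraph.comap (Fin.val : Fin n → ℕ) with hG
  set a := p ⟨0, by omega⟩ with ha
  set b := p ⟨1, by omega⟩ with hb
  let v : Fin (n - 2) → ℂ := fun i => p ⟨i + 2, by omega⟩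
  let c := p ⟨n - 2, by omega⟩
  let d := p ⟨n - 1, by omega⟩
  have hup : ∀ i, 0 < orient a b (v i) := fun i => orient_pos_nested hp (by omega) (by omega)
  have hupl : ∀ i, 0 < cross (b - a) (v i - a) := hup
  have hupr : ∀ i, 0 < cross (b - a) (v i - b) := fun i => by
    have : cross (b - a) (v i - b) = orient a b (v i) := by
      simp only [orient, cross, Complex.sub_re, Complex.sub_im]; ring
    rw [this]; exact hup i
  have hn1 : n - 2 + 1 = n - 1 := by omega
  have hleft : ∀ {k} (hk2 : 2 ≤ k) (hk : k + 1 < n),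
      0 < orient a (p ⟨k, by omega⟩) (p ⟨k + 1, hk⟩) := fun hk2 hk =>
    (cross_pos_left_step hp hk2 hk (orient_pos_nested hp (by omega) hk)).2
  have hcd1 : 0 < orient a c d := by
    have := hleft (show 2 ≤ n - 2 by omega) (by omega)
    simp only [hn1] at this
    exact this
  have hcd2 : 0 < orient b d c := by
    have := cross_pos_right_step hp (show 2 ≤ n - 2 by omega) (by omega)
    simp only [hn1] at this
    exact this
  have hd : 0 < orient a b d := orient_pos_last hp
  have hcd3 : 0 < cross (d - a) (d - c) := by
    have : cross (d - a) (d - c) = orient a c d := by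
      simp only [orient, cross, Complex.sub_re, Complex.sub_im]; ring
    rwa [this]
  have hcd4 : 0 < cross (d - c) (d - b) := by
    have : cross (d - c) (d - b) = orient b d c := by
      simp only [orient, cross, Complex.sub_re, Complex.sub_im]; ring
    rwa [this]
  have hdb : 0 < cross (b - a) (d - b) := by
    have : cross (b - a) (d - b) = orient a b d := by
      simp only [orient, cross, Complex.sub_re, Complex.sub_im]; ring
    rwa [this]
  -- By the two inequalities above, `d - c` is a positive combination of `d - a` and `d - b`, which
  -- both point to the left of `ab`; the identity is this combination with denominators cleared.
  have hcd : 0 < cross (b - a) (d - c) := by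
    have : cross (b - a) (d - c) * orient a b d =
        cross (b - a) (d - a) * cross (d - c) (d - b) +
          cross (b - a) (d - b) * cross (d - a) (d - c) := by
      simp only [orient, cross, Complex.sub_re, Complex.sub_im]; ring
    refine pos_of_mul_pos_left (b := orient a b d) ?_ hd.le
    rw [this]
    have hd' : 0 < cross (b - a) (d - a) := hd
    positivity
  let α : Fin (n - 2) → ℝ := fun i => cotan (b - a) (v i - a)
  let β : Fin (n - 2) → ℝ := fun i => cotan (b - a) (v i - b)
  let θ : Unit → ℝ := fun _ => cotan (b - a) (d - c)
  have hα : StrictAnti α :=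
    StrictMono.dual_right <| Fin.strictMono_of_lt_add_one (α := ℝᵒᵈ) fun i hi =>
      cotan_lt_cotan (hupl ⟨i, by omega⟩) (hupl ⟨i + 1, hi⟩)
        (hleft (k := i + 2) (by omega) (by omega))
  have hβ : StrictMono β := Fin.strictMono_of_lt_add_one fun i hi =>
    cotan_lt_cotan (hupr ⟨i + 1, hi⟩) (hupr ⟨i, by omega⟩)
      (cross_pos_right_step hp (k := i + 2) (by omega) (by omega))
  have hlast : v ⟨n - 3, by omega⟩ = d := congrArg p (Fin.ext (show n - 3 + 2 = n - 1 by omega))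
  -- The smallest cotangent at `0` and the largest at `1` both belong to the outer vertex `d`;
  -- comparing `d - c` with `d - a` and `d - b` therefore separates the two families.
  have hαθ : ∀ i u, θ u < α i := fun i u => by
    refine lt_of_lt_of_le ?_ (hα.antitone (show i ≤ ⟨n - 3, by omega⟩ from Fin.le_def.2 (by simp; omega)))
    have h1 := hupl ⟨n - 3, by omega⟩
    simp only [α, hlast] at h1 ⊢
    exact cotan_lt_cotan h1 hcd hcd3
  have hβθ : ∀ i u, β i < θ u := fun i u => by
    refine lt_of_le_of_lt (hβ.monotone (show i ≤ ⟨n - 3, by omega⟩ from Fin.le_def.2 (by simp; omega))) ?_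
    simp only [β, hlast]
    exact cotan_lt_cotan hcd hdb hcd4
  let D : Fin (n - 2) ⊕ Fin (n - 2) ⊕ Unit → G.Dart := Sum.elim
    (fun i => nestedDart n (x := 0) (y := i + 2) (by omega) (by omega) (by rw [nestedGraph_adj]; omega))
    (Sum.elim (fun i => nestedDart n (x := 1) (y := i + 2) (by omega) (by omega)
        (by rw [nestedGraph_adj]; omega))
      fun _ => nestedDart n (x := n - 2) (y := n - 1) (by omega) (by omega)
        (by rw [nestedGraph_adj]; omega))
  have hDup : ∀ i, 0 < cross (b - a) (p (D i).snd - p (D i).fst) := by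
    rintro (i | i | i)
    exacts [hupl i, hupr i, hcd]
  have hDcot : ∀ i, cotan (b - a) (p (D i).snd - p (D i).fst) = Sum.elim α (Sum.elim β θ) i := by
    rintro (i | i | i) <;> rfl
  have hinj : Function.Injective (Sum.elim α (Sum.elim β θ)) := by
    refine hα.injective.sumElim (hβ.injective.sumElim (fun _ _ _ => rfl) fun i u => (hβθ i u).ne) ?_
    rintro i (j | u)
    · exact ((hβθ j ()).trans (hαθ i ())).ne'
    · exact (hαθ i u).ne'
  -- The value `none` is the base edge `01`; all other chosen edges have positive cross product with
  -- it, so none is parallel to it.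
  let D' : Option (Fin (n - 2) ⊕ Fin (n - 2) ⊕ Unit) → G.Dart := fun o => o.elim
    (nestedDart n (x := 0) (y := 1) (by omega) (by omega) (by simp [nestedGraph_adj])) D
  have hne : ∀ e : G.Dart, p e.fst ≠ p e.snd := fun e => hp.injective.ne e.fst_ne_snd
  have hD'inj : Function.Injective fun o => slopeAngle (p (D' o).fst) (p (D' o).snd) := by
    rintro (_ | i) (_ | j) h
    · rfl
    · exact absurd ((slopeAngle_eq_iff (hne _) (hne _)).1 h) (hDup j).ne'
    · exact absurd ((slopeAngle_eq_iff (hne _) (hne _)).1 h.symm) (hDup i).ne'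
    · have h0 := (slopeAngle_eq_iff (hne _) (hne _)).1 h
      have h1 := cotan_eq_cotan (hDup i) (hDup j) h0
      rw [hDcot, hDcot] at h1
      rw [hinj h1]
  have hcard : Nat.card (Option (Fin (n - 2) ⊕ Fin (n - 2) ⊕ Unit)) = 2 * n - 2 := by
    simp only [Nat.card_eq_fintype_card, Fintype.card_option, Fintype.card_sum, Fintype.card_fin,
      Fintype.card_unit]
    omega
  rw [← hcard, ← Set.ncard_univ, ← Set.ncard_image_of_injective _ hD'inj]
  refine Set.ncard_le_ncard ?_ (Set.toFinite _)
  rintro _ ⟨o, -, rfl⟩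
  exact ⟨D' o, rfl⟩

end Nested

end

theorem mainTheorem7 :
    (∀ (V : Type u) [Fintype V] (G : SimpleGraph V) (P : PlaneEmbedding G), IsKTree 3 G →
      ∃ p : V → ℂ, P.IsPlaneDrawingOf p ∧
        numSegments G p ≤ 2 * Fintype.card V - 2 ∧
        numSlopes G p ≤ 2 * Fintype.card V - 2) ∧
    (∀ n : ℕ, 4 ≤ n →
      ∃ (G : SimpleGraph (Fin n)) (P : PlaneEmbedding G), IsKTree 3 G ∧
        ∀ p : Fin n → ℂ, P.IsPlaneDrawingOf p →
          2 * n - 2 ≤ numSlopes G p ∧ 2 * n - 2 ≤ numSegments G p) := by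
  refine ⟨fun V _ G P hG => ?_, fun n hn => ⟨_, nestedEmbedding hn, isKTree_nestedGraph hn,
    fun p hp => ?_⟩⟩
  · obtain ⟨p, hp, hseg⟩ := P.exists_isPlaneDrawingOf hG
    exact ⟨p, hp, hseg, (numSlopes_le_numSegments hp.injective).trans hseg⟩
  · have h := card_le_numSlopes_nested hp
    exact ⟨h, h.trans (numSlopes_le_numSegments hp.injective)⟩
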